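/- Let $D\ge 1$, and let $\mathcal V\subset\mathbb R^D$ be a finite set such that for every $d\in\{1,\dots,D\}$ the $d$-th coordinates of the points of $\mathcal V$ are not all equal. Put $\delta_d=\min\{|v_d-w_d| : v,w\in\mathcal V,\ v_d\ne w_d\}$, let $\mathcal B_v(\delta)=\{x\in\mathbb R^D : |x_d-v_d|\le\delta_d/2 \text{ for all } d\}$ for $v\in\mathcal V$, and let $\mathcal M_{\mathcal V}=\bigcup_{v\in\mathcal V}\mathcal B_v(\delta)$ be the voxel manifold. Let $\overline{\mathcal M}\subseteq\mathbb R^D$ be an open set containing $\mathcal M_{\mathcal V}$, and let $K:\overline{\mathcal M}\times\mathcal V\to\mathbb R$ be a kernel such that $K(\cdot,v)\in\mathcal C^3(\overline{\mathcal M})$ for all $v\in\mathcal V$. Let $X$ be a Gaussian random field on $\mathcal V$ (with arbitrary mean and covariance function $\mathfrak c$) such that $$\|K_x\|^2:=\sum_{u,v\in\mathcal V}K(x,u)K(x,v)\,\mathfrak c(u,v)>0\qquad\text{for all }x\in\mathcal M_{\mathcal V},$$ and let $X_1,\dots,X_N$ be i.i.d. copies of $X$. Consider the super-resolution fields (SuRFs)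 $\tilde X(x)=\sum_{v\in\mathcal V}K(x,v)X(v)$ and $\tilde X_i(x)=\sum_{v\in\mathcal V}K(x,v)X_i(v)$, and the Riemannian metric induced by the normalized SuRF, $$\Lambda_{dd'}(x)=\mathrm{Cov}\Big(\partial_d\frac{\tilde X(x)}{\|K_x\|},\ \partial_{d'}\frac{\tilde X(x)}{\|K_x\|}\Big).$$ Its estimator is $$\hat\Lambda_{dd'}(x)=\frac{\widehat{\mathrm{Cov}}[\partial_d\tilde{\mathbb X}(x),\partial_{d'}\tilde{\mathbb X}(x)]}{\widehat{\mathrm{Var}}[\tilde{\mathbb X}(x)]}-\frac{\widehat{\mathrm{Cov}}[\partial_d\tilde{\mathbb X}(x),\tilde{\mathbb X}(x)]\ \widehat{\mathrm{Cov}}[\tilde{\mathbb X}(x),\partial_{d'}\tilde{\mathbb X}(x)]}{\widehat{\mathrm{Var}}[\tilde{\mathbb X}(x)]^2},$$ where $\widehat{\mathrm{Cov}}$ and $\widehat{\mathrm{Var}}$ are the sample covariance and sample variance of $\tilde{\mathbb X}=(\tilde X_1,\dots,\tilde X_N)$ and its derivatives. For $I\subset\{1,\dots,D\}$ let $\boldsymbol\Lambda^I$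 be the submatrix of $\boldsymbol\Lambda$ with rows and columns in $I$ (similarly $\hat{\boldsymbol\Lambda}^I$). For $|I|=D-1$ let $\mathcal F_I\subset\mathcal M_{\mathcal V}\setminus\partial_D\mathcal M_{\mathcal V}$ be the part lying on the voxel faces on which the coordinate with index not in $I$ is constant; here the top-dimensional stratum $\partial_D\mathcal M_{\mathcal V}$ may be taken to be either the union of the open voxels or the interior of $\mathcal M_{\mathcal V}$. The two highest Lipschitz--Killing curvatures (LKCs), in the normalization in which the one of order $D-1$ is the Riemannian volume of the $(D-1)$-dimensional stratum, are $$\mathcal L_D=\sum_{v\in\mathcal V}\int_{\mathcal B_v(\delta)}\sqrt{\det\boldsymbol\Lambda(x)}\,dx,\qquad \mathcal L_{D-1}=\sum_{|I|=D-1}\int_{\mathcal F_I}\sqrt{\det\boldsymbol\Lambda^I(x)}\,dx^I .$$ For odd $r\ge1$ let $\mathcal M_{\mathcal V}^{(r)}=\bigcup_{v\in\mathcal V}\mathcal B_v(\delta)\cap\{v+(\tfrac{\delta_1 z_1}{r+1},\dots,\tfrac{\delta_D z_D}{r+1}) : z\in\mathbb Z^D\}$ and $\mathcal F_I^{(r)}=\mathcal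 F_I\cap\mathcal M_{\mathcal V}^{(r)}$. The SuRF-LKC estimators with added resolution $r$ are $$\hat{\mathcal L}_D^{(r)}=\sum_{x\in\mathcal M_{\mathcal V}^{(r)}}\sqrt{\det\hat{\boldsymbol\Lambda}(x)}\prod_{d=1}^D\frac{\delta_d}{r+1},\qquad \hat{\mathcal L}_{D-1}^{(r)}=\sum_{|I|=D-1}\ \sum_{x\in\mathcal F_I^{(r)}}\sqrt{\det\hat{\boldsymbol\Lambda}^I(x)}\prod_{i\in I}\frac{\delta_i}{r+1}.$$ Let $d\in\{D-1,D\}$ and assume that the sample size satisfies $N\ge d+2$. Then all the following expectations are finite, $\lim_{r\to\infty}\hat{\mathcal L}_d^{(r)}$ exists almost surely, and $$\lim_{r\to\infty}\mathbb E\big[\hat{\mathcal L}_d^{(r)}\big]=\mathbb E\Big[\lim_{r\to\infty}\hat{\mathcal L}_d^{(r)}\Big]=\mathcal L_d ,$$ where $r$ runs through the odd positive integers. -/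

import Mathlib

open MeasureTheory ProbabilityTheory Filter Topology

namespace SuRF

/-- The partial derivative `∂_d f (x)`. -/
noncomputable def pderiv {D : ℕ} (f : (Fin D → ℝ) → ℝ) (d : Fin D) (x : Fin D → ℝ) : ℝ :=
  fderiv ℝ f x (Pi.single d 1)

/-! ### Voxel manifolds -/

/-- `δ_d = min { |v_d - w_d| : v, w ∈ 𝒱, v_d ≠ w_d }`, the minimum of a finite set
(non-empty as soon as the voxels do not all share their `d`-th coordinate). -/
noncomputable def spacing {D : ℕ} (𝒱 : Finset (Fin D → ℝ)) (d : Fin D) : ℝ :=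
  sInf {t : ℝ | ∃ v ∈ 𝒱, ∃ w ∈ 𝒱, v d ≠ w d ∧ t = |v d - w d|}

/-- The closed voxel `B_v(δ)` centred at `v`. -/
def voxel {D : ℕ} (𝒱 : Finset (Fin D → ℝ)) (v : Fin D → ℝ) : Set (Fin D → ℝ) :=
  {x | ∀ d, |x d - v d| ≤ spacing 𝒱 d / 2}

/-- The voxel manifold `M_𝒱`. -/
def voxelManifold {D : ℕ} (𝒱 : Finset (Fin D → ℝ)) : Set (Fin D → ℝ) :=
  ⋃ v ∈ 𝒱, voxel 𝒱 v

/-- The union of the open voxels. -/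
def openVoxels {D : ℕ} (𝒱 : Finset (Fin D → ℝ)) : Set (Fin D → ℝ) :=
  ⋃ v ∈ 𝒱, interior (voxel 𝒱 v)

/-- The faces with constant `j`-th coordinate (so `I = {1, …, D} \ {j}`) in `M_𝒱 \ T`,
where `T` is the top-dimensional stratum of `M_𝒱`. -/
def faces {D : ℕ} (𝒱 : Finset (Fin D → ℝ)) (T : Set (Fin D → ℝ)) (j : Fin D) :
    Set (Fin D → ℝ) :=
  {x | x ∈ voxelManifold 𝒱 \ T ∧ ∃ v ∈ 𝒱, x ∈ voxel 𝒱 v ∧ |x j - v j| = spacing 𝒱 j / 2}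

/-- The finitely many values of the `j`-th coordinate on the faces orthogonal to `e_j`. -/
noncomputable def heights {D : ℕ} (𝒱 : Finset (Fin D → ℝ)) (j : Fin D) : Finset ℝ :=
  𝒱.image (fun v => v j - spacing 𝒱 j / 2) ∪ 𝒱.image (fun v => v j + spacing 𝒱 j / 2)

/-- The point of `ℝ^D` with `j`-th coordinate `c` and remaining coordinates `y`. -/
def glue {D : ℕ} (j : Fin D) (c : ℝ) (y : {i : Fin D // i ≠ j} → ℝ) : Fin D → ℝ :=
  fun i => if h : i = j then c else y ⟨i, h⟩

/-- `∫_{F_I} g(x) dx^I` for a set `F` of faces orthogonal to `e_j`, `I = {1, …, D} \ {j}`: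
Lebesgue integration over the coordinates in `I`, on each of the hyperplanes containing faces. -/
noncomputable def faceIntegral {D : ℕ} (𝒱 : Finset (Fin D → ℝ)) (j : Fin D)
    (F : Set (Fin D → ℝ)) (g : (Fin D → ℝ) → ℝ) : ℝ :=
  ∑ c ∈ heights 𝒱 j, ∫ y in {y : {i : Fin D // i ≠ j} → ℝ | glue j c y ∈ F}, g (glue j c y)

/-- The grid `M_𝒱^{(r)}` with added resolution `r`. -/
def grid {D : ℕ} (𝒱 : Finset (Fin D → ℝ)) (r : ℕ) : Set (Fin D → ℝ) :=
  ⋃ v ∈ 𝒱, voxel 𝒱 v ∩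
    {x | ∃ z : Fin D → ℤ, ∀ d, x d = v d + spacing 𝒱 d / ((r : ℝ) + 1) * (z d : ℝ)}

/-! ### Super-resolution fields and the induced Riemannian metric -/

/-- The super-resolution field `s ↦ ∑_v K(s, v) a(v)` of the data `a` on `𝒱`. -/
noncomputable def field {D : ℕ} {𝒱 : Finset (Fin D → ℝ)} (K : (Fin D → ℝ) → 𝒱 → ℝ)
    (a : 𝒱 → ℝ) (s : Fin D → ℝ) : ℝ :=
  ∑ v, K s v * a v

/-- `‖K_s‖² = ∑_{u, v} K(s, u) K(s, v) Cov(X(u), X(v))`. -/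
noncomputable def kernelNormSq {D : ℕ} {𝒱 : Finset (Fin D → ℝ)} {Ω : Type*} [MeasurableSpace Ω]
    (K : (Fin D → ℝ) → 𝒱 → ℝ) (X : Ω → 𝒱 → ℝ) (P : Measure Ω) (s : Fin D → ℝ) : ℝ :=
  ∑ u, ∑ v, K s u * K s v * cov[fun ω => X ω u, fun ω => X ω v; P]

/-- The kernel of the normalized super-resolution field. -/
noncomputable def normalizedKernel {D : ℕ} {𝒱 : Finset (Fin D → ℝ)} {Ω : Type*}
    [MeasurableSpace Ω] (K : (Fin D → ℝ) → 𝒱 → ℝ) (X : Ω → 𝒱 → ℝ) (P : Measure Ω) :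
    (Fin D → ℝ) → 𝒱 → ℝ :=
  fun s v => K s v / √(kernelNormSq K X P s)

/-- The Riemannian metric `Λ(x)` induced by the normalized super-resolution field `f`, in the
coordinates of `ℝ^D`: `Λ_{dd'}(x) = Cov(∂_d f(x), ∂_{d'} f(x))`. -/
noncomputable def metric {D : ℕ} {𝒱 : Finset (Fin D → ℝ)} {Ω : Type*} [MeasurableSpace Ω]
    (K : (Fin D → ℝ) → 𝒱 → ℝ) (X : Ω → 𝒱 → ℝ) (P : Measure Ω) (x : Fin D → ℝ) :
    Matrix (Fin D) (Fin D) ℝ :=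
  Matrix.of fun d d' =>
    cov[fun ω => pderiv (field (normalizedKernel K X P) (X ω)) d x,
        fun ω => pderiv (field (normalizedKernel K X P) (X ω)) d' x; P]

/-! ### The plug-in estimator of the metric -/

/-- The sample covariance (the sample variance for `a = b`). -/
noncomputable def sampleCov {N : ℕ} (a b : Fin N → ℝ) : ℝ :=
  (∑ i, (a i - (∑ k, a k) / (N : ℝ)) * (b i - (∑ k, b k) / (N : ℝ))) / ((N : ℝ) - 1)

/-- The estimator `Λ̂(x)` computed from the data `Y_1, …, Y_N` on `𝒱`. -/
noncomputable def metricEst {D N : ℕ} {𝒱 : Finset (Fin D → ℝ)} (K : (Fin D → ℝ) → 𝒱 → ℝ)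
    (Y : Fin N → 𝒱 → ℝ) (x : Fin D → ℝ) : Matrix (Fin D) (Fin D) ℝ :=
  let val : Fin N → ℝ := fun i => field K (Y i) x
  let der : Fin D → Fin N → ℝ := fun d i => pderiv (field K (Y i)) d x
  Matrix.of fun d d' =>
    sampleCov (der d) (der d') / sampleCov val val
      - sampleCov (der d) val * sampleCov val (der d') / sampleCov val val ^ 2

/-! ### The two highest Lipschitz-Killing curvatures and their estimators -/

/-- The volume density `√det A`. -/
noncomputable def vol {D : ℕ} (A : Matrix (Fin D) (Fin D) ℝ) : ℝ :=
  √A.det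

/-- The volume density `√det A^I` of the submatrix with rows and columns in
`I = {1, …, D} \ {j}`. -/
noncomputable def volMinor {D : ℕ} (j : Fin D) (A : Matrix (Fin D) (Fin D) ℝ) : ℝ :=
  √(A.submatrix (Subtype.val : {i : Fin D // i ≠ j} → Fin D)
      (Subtype.val : {i : Fin D // i ≠ j} → Fin D)).det

/-- `L_D = ∑_v ∫_{B_v(δ)} √det Λ(x) dx`, for a metric `Λ` on `M_𝒱`. -/
noncomputable def lkcTop {D : ℕ} (𝒱 : Finset (Fin D → ℝ))
    (Λ : (Fin D → ℝ) → Matrix (Fin D) (Fin D) ℝ) : ℝ :=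
  ∑ v ∈ 𝒱, ∫ x in voxel 𝒱 v, vol (Λ x)

/-- `L_{D-1} = ∑_{|I| = D-1} ∫_{F_I} √det Λ^I(x) dx^I`, where the top-dimensional stratum of
`M_𝒱` is `T`. -/
noncomputable def lkcFaces {D : ℕ} (𝒱 : Finset (Fin D → ℝ)) (T : Set (Fin D → ℝ))
    (Λ : (Fin D → ℝ) → Matrix (Fin D) (Fin D) ℝ) : ℝ :=
  ∑ j, faceIntegral 𝒱 j (faces 𝒱 T j) fun x => volMinor j (Λ x)

/-- The estimator of `L_D` with added resolution `r`, computed from the data `Y_1, …, Y_N`. -/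
noncomputable def lkcTopEst {D N : ℕ} {𝒱 : Finset (Fin D → ℝ)} (K : (Fin D → ℝ) → 𝒱 → ℝ)
    (r : ℕ) (Y : Fin N → 𝒱 → ℝ) : ℝ :=
  ∑ᶠ x ∈ grid 𝒱 r, vol (metricEst K Y x) * ∏ d, spacing 𝒱 d / ((r : ℝ) + 1)

/-- The estimator of `L_{D-1}` with added resolution `r`, computed from the data
`Y_1, …, Y_N`. -/
noncomputable def lkcFacesEst {D N : ℕ} {𝒱 : Finset (Fin D → ℝ)} (T : Set (Fin D → ℝ))
    (K : (Fin D → ℝ) → 𝒱 → ℝ) (r : ℕ) (Y : Fin N → 𝒱 → ℝ) : ℝ :=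
  ∑ j, ∑ᶠ x ∈ faces 𝒱 T j ∩ grid 𝒱 r,
    volMinor j (metricEst K Y x) * ∏ i : {i : Fin D // i ≠ j}, spacing 𝒱 i / ((r : ℝ) + 1)

/-- `lim_r E[L̂^{(r)}] = E[lim_r L̂^{(r)}] = L`, with `r` running through the odd numbers
`2 k + 1`: all expectations exist, and the inner limit exists almost surely. -/
def LimitsUnbiased {Ω : Type*} [MeasurableSpace Ω] (P : Measure Ω) (est : ℕ → Ω → ℝ)
    (L : ℝ) : Prop :=
  (∀ k : ℕ, Integrable (est (2 * k + 1)) P) ∧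
  Tendsto (fun k : ℕ => ∫ ω, est (2 * k + 1) ω ∂P) atTop (𝓝 L) ∧
  ∃ estLim : Ω → ℝ,
    (∀ᵐ ω ∂P, Tendsto (fun k : ℕ => est (2 * k + 1) ω) atTop (𝓝 (estLim ω))) ∧
    Integrable estLim P ∧ ∫ ω, estLim ω ∂P = L

end SuRF

/-! Let `d` be the dimension of the stratum. At a fixed point, the value and the `d` derivatives of
the SuRF form a Gaussian vector with `q = d + 1` entries; let `C` be its covariance matrix, `S` its
sample covariance matrix and `o` the index of the value. The metric and its estimator are the Schur
complements of the entries `C_oo` and `S_oo`, divided by these entries. By `det_normSchur` the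
volume densities are therefore `√(det C / C_oo^q)` and `√(det S / S_oo^q)`. The core of the proof is
that the second is an exactly unbiased estimator of the first (`lintegral_sqrt_det_div`).

No density of `S` is needed for this. Integrate `√(det S) exp(-tᵀSt/2)` over `t ∈ ℝ^q` and over the
sample. Integrating over `t` first gives the Gaussian constant `c`, whatever `S` is. On the other
hand, the expectation for fixed `t` depends only on `tᵀCt`: the law of `S` is invariant under `S ↦
QSQᵀ` if `QCQᵀ = C`, and such `Q` carry `t` to any vector of the same `C`-length. So `t` may be
replaced by a multiple of `e_o`; the exponent becomes `-(S_oo/C_oo) tᵀCt/2`, and the integral over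
`t` is now `c √(det S / S_oo^q) / √(det C / C_oo^q)`. Its expectation must be `c`. The argument uses
that `S` is almost surely invertible, which holds for `N ≥ q + 1 = d + 2`; for singular `C` both
densities vanish almost surely.

Consequently the expected estimator is the Riemann sum of the true density, and it converges. For
the almost sure limit the estimated density has to be continuous, so the sample variance must have
no zero on a `d`-dimensional box. A zero means `N - 1 ≥ d + 1` independent coincidences somewhere in
a `d`-parameter family, which a net argument excludes (`ae_sampleCov_pos`). The limit is the
integral of the estimated density, and Tonelli gives its expectation; no bound uniform in `r` is
needed.

Geometrically, both strata are unions of boxes with disjoint interiors (`IsBoxUnion`), the faces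
being sorted by the hyperplanes that contain them. Grid points on common boundaries are counted
once, which is harmless because the density is nonnegative and boundaries are null sets. -/

namespace SuRF

open Matrix

/-! ### Sample covariance matrices -/

/-- The sample covariance matrix of the vectors `z_1, …, z_N`. -/
noncomputable def sampleCovMatrix {N : ℕ} {κ : Type*} (z : Fin N → κ → ℝ) : Matrix κ κ ℝ :=
  of fun a b => sampleCov (fun i => z i a) (fun i => z i b)

theorem sampleCov_comm {N : ℕ} (a b : Fin N → ℝ) : sampleCov a b = sampleCov b a := by
  simp [sampleCov, mul_comm]

theorem sampleCovMatrix_isHermitian {N : ℕ} {κ : Type*} (z : Fin N → κ → ℝ) :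
    (sampleCovMatrix z).IsHermitian := by
  ext a b
  simp [sampleCovMatrix, sampleCov_comm]

/-- Subtracting the sample mean cancels the constants `k` and `l`, and what remains is bilinear.
This translation invariance is why the unknown mean of the field plays no role. -/
theorem sampleCov_dotProduct_add {N : ℕ} {κ : Type*} [Fintype κ] (z : Fin N → κ → ℝ)
    (c d : κ → ℝ) (k l : ℝ) :
    sampleCov (fun i => c ⬝ᵥ z i + k) (fun i => d ⬝ᵥ z i + l)
      = c ⬝ᵥ (sampleCovMatrix z *ᵥ d) := by
  rcases Nat.eq_zero_or_pos N with rfl | hN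
  · simp [sampleCov, sampleCovMatrix, dotProduct, mulVec]
  have hN' : (N : ℝ) ≠ 0 := by positivity
  have key : ∀ (c : κ → ℝ) (k : ℝ) (i : Fin N),
      c ⬝ᵥ z i + k - (∑ j, (c ⬝ᵥ z j + k)) / (N : ℝ)
        = ∑ a, c a * (z i a - (∑ j, z j a) / N) := by
    intro c k i
    have h1 : ∑ j, (c ⬝ᵥ z j + k) = (∑ a, c a * ∑ j, z j a) + N * k := by
      simp only [dotProduct, Finset.sum_add_distrib, Finset.mul_sum]
      rw [Finset.sum_comm]
      simp
    rw [h1, add_div, mul_div_cancel_left₀ _ hN']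
    simp only [dotProduct, mul_sub, Finset.sum_sub_distrib, Finset.sum_div, mul_div_assoc]
    ring
  simp only [sampleCov, key, sampleCovMatrix]
  have aux : ∀ (w : Fin N → κ → ℝ) (m : ℝ), (∑ i, (∑ a, c a * w i a) * ∑ a, d a * w i a) / m
      = c ⬝ᵥ ((of fun a b => (∑ i, w i a * w i b) / m) *ᵥ d) := by
    intro w m
    simp only [dotProduct, mulVec, of_apply, Finset.mul_sum, Finset.sum_mul, Finset.sum_div]
    rw [Finset.sum_comm, Finset.sum_congr rfl fun _ _ => Finset.sum_comm, Finset.sum_comm]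
    refine Finset.sum_congr rfl fun a _ => Finset.sum_congr rfl fun b _ =>
      Finset.sum_congr rfl fun i _ => ?_
    ring
  exact aux (fun i a => z i a - (∑ j, z j a) / (N : ℝ)) _

theorem sampleCov_dotProduct {N : ℕ} {κ : Type*} [Fintype κ] (z : Fin N → κ → ℝ)
    (c d : κ → ℝ) :
    sampleCov (fun i => c ⬝ᵥ z i) (fun i => d ⬝ᵥ z i) = c ⬝ᵥ (sampleCovMatrix z *ᵥ d) := by
  simpa using sampleCov_dotProduct_add z c d 0 0

theorem sampleCovMatrix_affine {N : ℕ} {κ : Type*} [Fintype κ] (z : Fin N → κ → ℝ)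
    (Q : Matrix κ κ ℝ) (k : κ → ℝ) :
    sampleCovMatrix (fun i => Q *ᵥ z i + k) = Q * sampleCovMatrix z * Qᵀ := by
  ext a b
  have h := sampleCov_dotProduct_add z (Q a) (Q b) (k a) (k b)
  simp only [sampleCovMatrix, of_apply, Pi.add_apply, mulVec] at h ⊢
  rw [h, Matrix.mul_assoc, mul_apply]
  rfl

theorem sampleCov_self_nonneg {N : ℕ} (hN : 1 ≤ N) (a : Fin N → ℝ) : 0 ≤ sampleCov a a := by
  have : (1 : ℝ) ≤ N := by exact_mod_cast hN
  exact div_nonneg (Finset.sum_nonneg fun i _ => mul_self_nonneg _) (by linarith)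

theorem sampleCov_self_eq_zero {N : ℕ} (hN : 2 ≤ N) {a : Fin N → ℝ} (h : sampleCov a a = 0)
    (i j : Fin N) : a i = a j := by
  have : (2 : ℝ) ≤ N := by exact_mod_cast hN
  have h' := (div_eq_zero_iff.1 h).resolve_right (by linarith)
  rw [Finset.sum_eq_zero_iff_of_nonneg fun i _ => mul_self_nonneg _] at h'
  have hi := mul_self_eq_zero.1 (h' i (Finset.mem_univ _))
  have hj := mul_self_eq_zero.1 (h' j (Finset.mem_univ _))
  linarith

theorem sampleCov_self_of_const {N : ℕ} {a : Fin N → ℝ} (h : ∀ i j, a i = a j) :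
    sampleCov a a = 0 := by
  rcases Nat.eq_zero_or_pos N with rfl | hN
  · simp [sampleCov]
  have hN' : (N : ℝ) ≠ 0 := by positivity
  have : ∀ i, ∑ k, a k = N * a i := fun i => by
    rw [Finset.sum_congr rfl fun k _ => h k i]; simp
  simp [sampleCov, fun i => show a i - (∑ k, a k) / (N : ℝ) = 0 by rw [this i]; field_simp; simp]

theorem sampleCovMatrix_posSemidef {N : ℕ} (hN : 1 ≤ N) {κ : Type*} [Fintype κ]
    (z : Fin N → κ → ℝ) : (sampleCovMatrix z).PosSemidef := by
  refine .of_dotProduct_mulVec_nonneg (sampleCovMatrix_isHermitian z) fun t => ?_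
  rw [star_trivial, ← sampleCov_dotProduct]
  exact sampleCov_self_nonneg hN _

theorem sampleCov_continuous {N : ℕ} :
    Continuous fun p : (Fin N → ℝ) × (Fin N → ℝ) => sampleCov p.1 p.2 := by
  unfold sampleCov
  fun_prop

theorem sampleCovMatrix_continuous {N : ℕ} {κ : Type*} :
    Continuous (sampleCovMatrix : (Fin N → κ → ℝ) → Matrix κ κ ℝ) := by
  refine continuous_matrix fun a b => ?_
  exact sampleCov_continuous.comp (f := fun z : Fin N → κ → ℝ =>
    ((fun i => z i a, fun i => z i b) : (Fin N → ℝ) × (Fin N → ℝ))) (by fun_prop)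

/-! ### The normalized Schur complement -/

/-- The Schur complement of the entry `S none none`, divided by that entry. -/
noncomputable def normSchur {ι : Type*} (S : Matrix (Option ι) (Option ι) ℝ) : Matrix ι ι ℝ :=
  of fun i j => S (some i) (some j) / S none none
    - S (some i) none * S none (some j) / S none none ^ 2

/-- Block determinant formula with a `1 × 1` block: the block contributes one factor `S none none`,
and the Schur complement is `S none none • normSchur S`, which contributes one more factor for each
element of `ι`. -/
theorem det_normSchur {ι : Type*} [Fintype ι] [DecidableEq ι]
    (S : Matrix (Option ι) (Option ι) ℝ) (h : S none none ≠ 0) :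
    (normSchur S).det = S.det / S none none ^ (Fintype.card ι + 1) := by
  set s := S none none with hs
  set e : Unit ⊕ ι ≃ Option ι := (Equiv.sumComm _ _).trans (Equiv.optionEquivSumPUnit ι).symm
  have h1 : S.submatrix e e = fromBlocks (of fun _ _ => s) (of fun _ j => S none (some j))
      (of fun i _ => S (some i) none) (of fun i j => S (some i) (some j)) := by
    ext (i | i) (j | j) <;> simp [e, hs]
  have hdet : IsUnit (of fun _ _ : Unit => s).det := by simpa using h
  let _ : Invertible (of fun _ _ : Unit => s) := invertibleOfIsUnitDet _ hdet
  have hinv : ⅟(of fun _ _ : Unit => s) = of fun _ _ : Unit => s⁻¹ := by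
    refine invOf_eq_right_inv ?_
    ext i j
    simp [mul_apply, h]
  rw [← det_submatrix_equiv_self e S, h1, det_fromBlocks₁₁, hinv]
  have h2 : (of fun i j => S (some i) (some j)) - (of fun i (_ : Unit) => S (some i) none)
      * (of fun _ _ : Unit => s⁻¹) * (of fun (_ : Unit) j => S none (some j))
      = s • normSchur S := by
    ext i j
    simp [mul_apply, normSchur, ← hs]
    field_simp
  rw [h2, det_smul]
  simp
  field_simp
  ring

/-! ### A Gaussian integral -/

-- Write `S = BᵀB` with `B` the square root of `S` and substitute `B t` for `t`. The constant on the
-- right is left unevaluated, because it cancels later and only has to be finite and nonzero.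
open scoped MatrixOrder in
theorem lintegral_exp_neg_quadForm {κ : Type*} [Fintype κ] [DecidableEq κ]
    {S : Matrix κ κ ℝ} (hS : S.PosDef) :
    ∫⁻ t : κ → ℝ, ENNReal.ofReal (Real.exp (-(t ⬝ᵥ (S *ᵥ t)) / 2))
      = ENNReal.ofReal (√S.det)⁻¹
        * ∫⁻ t : κ → ℝ, ENNReal.ofReal (Real.exp (-(t ⬝ᵥ t) / 2)) := by
  obtain ⟨B, hB⟩ : ∃ B : Matrix κ κ ℝ, S = Bᵀ * B := by
    have h := (CFC.sqrt_nonneg S).posSemidef.isHermitian.eq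
    rw [conjTranspose_eq_transpose_of_trivial] at h
    exact ⟨CFC.sqrt S, by rw [h, CFC.sqrt_mul_sqrt_self S hS.posSemidef.nonneg]⟩
  have hdet : S.det = B.det ^ 2 := by rw [hB, det_mul, det_transpose, sq]
  have hB0 : B.det ≠ 0 := fun h => by
    have := hS.det_pos
    rw [hdet, h] at this
    simp at this
  have hmap := Real.map_matrix_volume_pi_eq_smul_volume_pi hB0
  have hquad : ∀ t, t ⬝ᵥ (S *ᵥ t) = (toLin' B t) ⬝ᵥ (toLin' B t) := fun t => by
    rw [toLin'_apply, hB, ← mulVec_mulVec, dotProduct_mulVec, vecMul_transpose]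
  have hmeas : Measurable fun t : κ → ℝ => ENNReal.ofReal (Real.exp (-(t ⬝ᵥ t) / 2)) := by
    unfold dotProduct
    fun_prop
  have hm : Measurable (toLin' B) := by
    exact (LinearMap.continuous_of_finiteDimensional _).measurable
  simp_rw [hquad]
  rw [← lintegral_map (g := toLin' B) hmeas hm, hmap, lintegral_smul_measure, hdet,
    Real.sqrt_sq_eq_abs, abs_inv]
  rfl

theorem lintegral_exp_neg_dotProduct_ne_top {κ : Type*} [Fintype κ] :
    ∫⁻ t : κ → ℝ, ENNReal.ofReal (Real.exp (-(t ⬝ᵥ t) / 2)) ≠ ⊤ := by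
  have h : Integrable fun t : κ → ℝ => ∏ i, Real.exp (-(1 / 2) * t i ^ 2) :=
    Integrable.fintype_prod (f := fun _ x => Real.exp (-(1 / 2) * x ^ 2))
      fun _ => integrable_exp_neg_mul_sq (by norm_num)
  have h2 : ∀ t : κ → ℝ, Real.exp (-(t ⬝ᵥ t) / 2) = ∏ i, Real.exp (-(1 / 2) * t i ^ 2) := by
    intro t
    rw [← Real.exp_sum, dotProduct, ← Finset.mul_sum]
    congr 1
    simp only [sq]
    ring
  simp_rw [h2]
  exact h.lintegral_lt_top.ne

theorem lintegral_exp_neg_dotProduct_ne_zero {κ : Type*} [Fintype κ] :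
    ∫⁻ t : κ → ℝ, ENNReal.ofReal (Real.exp (-(t ⬝ᵥ t) / 2)) ≠ 0 := by
  have hmeas : Measurable fun t : κ → ℝ => ENNReal.ofReal (Real.exp (-(t ⬝ᵥ t) / 2)) := by
    unfold dotProduct
    fun_prop
  rw [← pos_iff_ne_zero, lintegral_pos_iff_support hmeas]
  have : (Function.support fun t : κ → ℝ => ENNReal.ofReal (Real.exp (-(t ⬝ᵥ t) / 2)))
      = Set.univ := by
    ext t
    simp [Real.exp_pos]
  rw [this]
  exact (isOpen_univ.measure_pos _ Set.univ_nonempty)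

end SuRF

namespace SuRF

open Matrix

/-! ### Gaussian measures on `ℝ^κ` -/

section Gaussian

variable {κ : Type*} [Fintype κ]

/-- The covariance matrix of a measure on `ℝ^κ`. -/
noncomputable def covMatrix (γ : Measure (κ → ℝ)) : Matrix κ κ ℝ :=
  of fun a b => cov[fun x => x a, fun x => x b; γ]

theorem continuous_dotProduct_right (c : κ → ℝ) : Continuous fun x : κ → ℝ => c ⬝ᵥ x := by
  unfold dotProduct
  fun_prop

theorem memLp_eval_of_isGaussian (γ : Measure (κ → ℝ)) [IsGaussian γ] (a : κ) :
    MemLp (fun x : κ → ℝ => x a) 2 γ :=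
  IsGaussian.memLp_dual γ (ContinuousLinearMap.proj a) 2 (by norm_num)

theorem covariance_dotProduct (γ : Measure (κ → ℝ)) [IsGaussian γ] (c d : κ → ℝ) :
    cov[fun x => c ⬝ᵥ x, fun x => d ⬝ᵥ x; γ] = c ⬝ᵥ (covMatrix γ *ᵥ d) := by
  have h := memLp_eval_of_isGaussian γ
  simp only [dotProduct]
  rw [covariance_fun_sum_fun_sum (fun a => (h a).const_mul (c a))
    (fun a => (h a).const_mul (d a))]
  simp only [covariance_const_mul_left, covariance_const_mul_right, mulVec, dotProduct,
    covMatrix, of_apply, Finset.mul_sum]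
  exact Finset.sum_congr rfl fun a _ => Finset.sum_congr rfl fun b _ => by ring

theorem variance_dotProduct (γ : Measure (κ → ℝ)) [IsGaussian γ] (c : κ → ℝ) :
    Var[fun x => c ⬝ᵥ x; γ] = c ⬝ᵥ (covMatrix γ *ᵥ c) := by
  rw [← covariance_dotProduct, covariance_self]
  exact (continuous_dotProduct_right c).measurable.aemeasurable

omit [Fintype κ] in
theorem covMatrix_isHermitian (γ : Measure (κ → ℝ)) : (covMatrix γ).IsHermitian := by
  ext a b
  simp [covMatrix, covariance_comm]

theorem covMatrix_posSemidef (γ : Measure (κ → ℝ)) [IsGaussian γ] :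
    (covMatrix γ).PosSemidef := by
  refine .of_dotProduct_mulVec_nonneg (covMatrix_isHermitian γ) fun t => ?_
  rw [star_trivial, ← variance_dotProduct]
  exact variance_nonneg _ _

theorem dual_apply_eq_dotProduct [DecidableEq κ] (L : StrongDual ℝ (κ → ℝ)) (x : κ → ℝ) :
    L x = (fun a => L (Pi.single a 1)) ⬝ᵥ x := by
  conv_lhs => rw [← Finset.univ_sum_single x]
  rw [map_sum]
  refine Finset.sum_congr rfl fun a _ => ?_
  have : (Pi.single a (x a) : κ → ℝ) = x a • Pi.single a 1 := by
    rw [← Pi.single_smul]; simp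
  rw [this, map_smul, smul_eq_mul, mul_comm]

/-- Gaussian measures are invariant under the affine maps that fix mean and covariance. -/
theorem map_affine_eq_self [DecidableEq κ] (γ : Measure (κ → ℝ)) [IsGaussian γ]
    {Q : Matrix κ κ ℝ} (hQ : Q * covMatrix γ * Qᵀ = covMatrix γ) :
    ∃ k : κ → ℝ, γ.map (fun x => Q *ᵥ x + k) = γ := by
  set m : κ → ℝ := fun a => ∫ x, x a ∂γ with hm
  -- This translation restores the mean. The condition on `Q` preserves the variance of every linear
  -- form, and these two data determine the characteristic function of a Gaussian measure.
  refine ⟨m - Q *ᵥ m, ?_⟩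
  set k := m - Q *ᵥ m
  have hlin : (fun x : κ → ℝ => Q *ᵥ x + k)
      = (fun x => x + k) ∘ (LinearMap.toContinuousLinearMap (toLin' Q)) := by
    ext x; simp
  have hmeas : Measurable (fun x : κ → ℝ => Q *ᵥ x + k) := by
    rw [hlin]; fun_prop
  have : IsGaussian (γ.map (fun x : κ → ℝ => Q *ᵥ x + k)) := by
    rw [hlin, ← Measure.map_map (by fun_prop) (by fun_prop)]
    infer_instance
  have hint : ∀ c : κ → ℝ, Integrable (fun x => c ⬝ᵥ x) γ := fun c => by
    unfold dotProduct
    exact integrable_finsetSum _ fun a _ =>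
      ((memLp_eval_of_isGaussian γ a).integrable (by norm_num)).const_mul _
  have hmean : ∀ c : κ → ℝ, ∫ x, c ⬝ᵥ x ∂γ = c ⬝ᵥ m := fun c => by
    unfold dotProduct
    rw [integral_finsetSum _ fun a _ =>
      ((memLp_eval_of_isGaussian γ a).integrable (by norm_num)).const_mul _]
    simp [integral_const_mul, hm]
  refine Measure.ext_of_charFunDual ?_
  ext L
  set c : κ → ℝ := fun a => L (Pi.single a 1) with hc
  have hL : ∀ x, L x = c ⬝ᵥ x := dual_apply_eq_dotProduct L
  have hLQ : ∀ x, L (Q *ᵥ x + k) = (c ᵥ* Q) ⬝ᵥ x + c ⬝ᵥ k := fun x => by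
    rw [hL, dotProduct_add, dotProduct_mulVec]
  rw [IsGaussian.charFunDual_eq, IsGaussian.charFunDual_eq]
  have e1 : ∫ x, L x ∂(γ.map (fun x => Q *ᵥ x + k)) = ∫ x, L x ∂γ := by
    rw [integral_map hmeas.aemeasurable (by fun_prop)]
    simp_rw [hLQ]
    rw [integral_add (hint _) (integrable_const _), hmean]
    simp_rw [hL]
    rw [hmean]
    simp [k, ← dotProduct_mulVec]
  have e2 : Var[L; γ.map (fun x => Q *ᵥ x + k)] = Var[L; γ] := by
    rw [variance_map (by fun_prop) hmeas.aemeasurable]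
    have h1 : (L ∘ fun x => Q *ᵥ x + k) = fun x => (c ᵥ* Q) ⬝ᵥ x + c ⬝ᵥ k := funext hLQ
    have h2 : (L : (κ → ℝ) → ℝ) = fun x => c ⬝ᵥ x := funext hL
    rw [h1, variance_add_const (continuous_dotProduct_right _).aestronglyMeasurable, variance_dotProduct, h2,
      variance_dotProduct]
    conv_rhs => rw [← hQ, ← mulVec_mulVec, ← mulVec_mulVec, dotProduct_mulVec, mulVec_transpose]
  simp only [integral_complex_ofReal, e1, e2]

/-- A proper subspace lies in the kernel of a nonzero linear form; the law of that form is a real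
Gaussian of positive variance, which has no atoms. -/
theorem measure_affineSubspace_eq_zero (γ : Measure (κ → ℝ)) [IsGaussian γ]
    (hpos : (covMatrix γ).PosDef) (c : κ → ℝ) {p : Submodule ℝ (κ → ℝ)} (hp : p < ⊤) :
    γ {x | x - c ∈ p} = 0 := by
  classical
  obtain ⟨f, hf0, hf⟩ := Submodule.exists_le_ker_of_lt_top p hp
  set L : StrongDual ℝ (κ → ℝ) := LinearMap.toContinuousLinearMap f
  set ℓ : κ → ℝ := fun a => L (Pi.single a 1) with hℓ
  have hL : ∀ x, L x = ℓ ⬝ᵥ x := dual_apply_eq_dotProduct L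
  have hℓ0 : ℓ ≠ 0 := fun h => hf0 <| by
    ext1 a
    have := congrFun h a
    ext
    simpa [hℓ, L] using this
  have hvar : 0 < Var[L; γ] := by
    have h2 : (L : (κ → ℝ) → ℝ) = fun x => ℓ ⬝ᵥ x := funext hL
    rw [h2, variance_dotProduct]
    simpa using hpos.dotProduct_mulVec_pos hℓ0
  have hsub : {x | x - c ∈ p} ⊆ L ⁻¹' {L c} := fun x hx => by
    have := hf hx
    rw [LinearMap.mem_ker, map_sub, sub_eq_zero] at this
    exact this
  refine measure_mono_null hsub ?_
  rw [← Measure.map_apply (by fun_prop) (measurableSet_singleton _),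
    IsGaussian.map_eq_gaussianReal L]
  have := nullSingletonClass_gaussianReal (μ := γ[L]) (v := (Var[L; γ]).toNNReal)
    (by simpa using hvar)
  exact measure_singleton _

/-- Induction with Fubini: fewer than `card κ` vectors span a proper subspace, and an independent
further point almost surely avoids its translate by `c`. -/
theorem ae_linearIndependent_sub (γ : Measure (κ → ℝ)) [IsGaussian γ]
    (hpos : (covMatrix γ).PosDef) (c : κ → ℝ) (k : ℕ) (hk : k ≤ Fintype.card κ) :
    ∀ᵐ z ∂(Measure.pi fun _ : Fin k => γ), LinearIndependent ℝ (fun i => z i - c) := by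
  induction k with
  | zero => exact Eventually.of_forall fun z => linearIndependent_empty_type
  | succ k ih =>
    have hmp := measurePreserving_piFinSuccAbove (fun _ : Fin (k + 1) => γ) 0
    have hopen : MeasurableSet {p : (κ → ℝ) × (Fin k → κ → ℝ) |
        LinearIndependent ℝ (Fin.cons (p.1 - c) (fun i => p.2 i - c) : Fin (k + 1) → κ → ℝ)} := by
      refine (IsOpen.preimage (f := fun p : (κ → ℝ) × (Fin k → κ → ℝ) =>
        (Fin.cons (p.1 - c) (fun i => p.2 i - c) : Fin (k + 1) → κ → ℝ)) ?_
        isOpen_setOfPred_linearIndependent).measurableSet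
      refine continuous_pi fun i => ?_
      refine Fin.cases ?_ (fun i => ?_) i
      · simp only [Fin.cons_zero]; fun_prop
      · simp only [Fin.cons_succ]; fun_prop
    have h : ∀ᵐ p ∂(γ.prod (Measure.pi fun _ : Fin k => γ)),
        LinearIndependent ℝ (Fin.cons (p.1 - c) (fun i => p.2 i - c) : Fin (k + 1) → κ → ℝ) := by
      rw [Measure.ae_prod_iff_ae_ae hopen, Measure.ae_ae_comm hopen]
      filter_upwards [ih (by omega)] with v hv
      have hlt : Submodule.span ℝ (Set.range fun i => v i - c) < ⊤ := by
        refine lt_top_iff_ne_top.2 fun h => ?_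
        have h1 := finrank_span_eq_card hv
        rw [h, finrank_top, Module.finrank_fintype_fun_eq_card, Fintype.card_fin] at h1
        omega
      have := measure_affineSubspace_eq_zero γ hpos c hlt
      rw [ae_iff]
      refine measure_mono_null (fun x hx => ?_) this
      by_contra hx'
      exact hx (linearIndependent_finCons.2 ⟨hv, hx'⟩)
    have := hmp.quasiMeasurePreserving.ae h
    filter_upwards [this] with z hz
    convert! hz using 1
    ext i
    refine Fin.cases ?_ (fun i => ?_) i <;> simp [MeasurableEquiv.piFinSuccAbove, Fin.tail]

theorem measurePreserving_pi_precomp {E : Type*} [MeasurableSpace E] (γ : Measure E)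
    [IsProbabilityMeasure γ] {m N : ℕ} (f : Fin m → Fin N) (hf : f.Injective) :
    MeasurePreserving (fun (z : Fin N → E) i => z (f i))
      (Measure.pi fun _ : Fin N => γ) (Measure.pi fun _ : Fin m => γ) := by
  refine ⟨by fun_prop, ?_⟩
  have h1 : iIndepFun (fun (i : Fin N) (z : Fin N → E) => z i) (Measure.pi fun _ => γ) :=
    iIndepFun_pi (X := fun _ => id) fun _ => aemeasurable_id
  rw [(h1.precomp hf).map_fun_eq_pi_map fun i => (measurable_pi_apply _).aemeasurable]
  congr 1
  ext1 i
  exact (measurePreserving_eval (fun _ : Fin N => γ) (f i)).map_eq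

/-- The sample covariance matrix of a nondegenerate Gaussian sample is almost surely
nondegenerate as soon as the sample is larger than the dimension. -/
theorem ae_sampleCovMatrix_posDef (γ : Measure (κ → ℝ)) [IsGaussian γ]
    (hpos : (covMatrix γ).PosDef) {N : ℕ} (hN : Fintype.card κ + 1 ≤ N) :
    ∀ᵐ z ∂(Measure.pi fun _ : Fin N => γ), (sampleCovMatrix z).PosDef := by
  rcases isEmpty_or_nonempty κ with hκ | hκ
  · refine Eventually.of_forall fun z => .of_dotProduct_mulVec_pos
      (sampleCovMatrix_isHermitian z) fun t ht => absurd (Subsingleton.elim t 0) ht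
  have hcard : 1 ≤ Fintype.card κ := Fintype.card_pos
  set q := Fintype.card κ with hq
  -- Given the point `z 0`, used as the centre `c`, the differences from it to `q` further points
  -- are almost surely a basis. Hence `q + 1` sample points suffice and the others can be ignored.
  have h1 : ∀ᵐ z ∂(Measure.pi fun _ : Fin (q + 1) => γ),
      LinearIndependent ℝ (fun i : Fin q => z i.succ - z 0) := by
    have hmp := measurePreserving_piFinSuccAbove (fun _ : Fin (q + 1) => γ) 0
    have hopen : MeasurableSet {p : (κ → ℝ) × (Fin q → κ → ℝ) |
        LinearIndependent ℝ (fun i => p.2 i - p.1)} :=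
      (IsOpen.preimage (f := fun p : (κ → ℝ) × (Fin q → κ → ℝ) => (fun i => p.2 i - p.1))
        (by fun_prop) isOpen_setOfPred_linearIndependent).measurableSet
    have h : ∀ᵐ p ∂(γ.prod (Measure.pi fun _ : Fin q => γ)),
        LinearIndependent ℝ (fun i => p.2 i - p.1) := by
      rw [Measure.ae_prod_iff_ae_ae hopen]
      exact Eventually.of_forall fun x => ae_linearIndependent_sub γ hpos x q le_rfl
    have := hmp.quasiMeasurePreserving.ae h
    filter_upwards [this] with z hz
    exact hz
  have h2 := (measurePreserving_pi_precomp γ (Fin.castLE hN)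
    (Fin.castLE_injective hN)).quasiMeasurePreserving.ae h1
  filter_upwards [h2] with z hz
  refine .of_dotProduct_mulVec_pos (sampleCovMatrix_isHermitian z) fun t ht => ?_
  rw [star_trivial, ← sampleCov_dotProduct]
  -- If the quadratic form vanishes at `t`, then `t ⬝ᵥ z i` does not depend on `i`, so `t` is
  -- orthogonal to the spanning differences.
  refine lt_of_le_of_ne (sampleCov_self_nonneg (by omega) _) fun h0 => ht ?_
  have hconst := sampleCov_self_eq_zero (by omega) h0.symm
  have hspan := hz.span_eq_top_of_card_eq_finrank (by simp [hq])
  have hz0 : ∀ x : κ → ℝ, t ⬝ᵥ x = 0 := by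
    intro x
    have hx : x ∈ Submodule.span ℝ (Set.range fun i : Fin q =>
      z (Fin.castLE hN i.succ) - z (Fin.castLE hN 0)) := by rw [hspan]; trivial
    induction hx using Submodule.span_induction with
    | mem x hx =>
      obtain ⟨i, rfl⟩ := hx
      simp only [dotProduct_sub]
      rw [hconst, sub_self]
    | zero => simp
    | add x y _ _ hx hy => rw [dotProduct_add, hx, hy, add_zero]
    | smul r x _ hx => rw [dotProduct_smul, hx, smul_zero]
  exact dotProduct_self_eq_zero.1 (hz0 t)

end Gaussian

end SuRF

namespace SuRF

open Matrix

/-! ### Unbiasedness of the normalized volume of a Gaussian sample -/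

section Unbiased

variable {κ : Type*} [Fintype κ] [DecidableEq κ]

/-- A linear map preserving the quadratic form of `C` acts transitively on its level sets. -/
theorem exists_reflection {C : Matrix κ κ ℝ} (hC : C.PosDef) {s t : κ → ℝ}
    (hst : s ⬝ᵥ (C *ᵥ s) = t ⬝ᵥ (C *ᵥ t)) :
    ∃ Q : Matrix κ κ ℝ, Q * C * Qᵀ = C ∧ Qᵀ *ᵥ t = s := by
  by_cases h : t = s
  · exact ⟨1, by simp, by simp [h]⟩
  have hsymm : Cᵀ = C := by
    rw [← conjTranspose_eq_transpose_of_trivial, hC.isHermitian.eq]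
  set u := t - s with hu
  have hu0 : u ≠ 0 := sub_ne_zero.2 h
  have hcomm : ∀ x y : κ → ℝ, x ⬝ᵥ (C *ᵥ y) = y ⬝ᵥ (C *ᵥ x) := fun x y => by
    rw [dotProduct_mulVec, ← mulVec_transpose, hsymm, dotProduct_comm]
  set m := u ⬝ᵥ (C *ᵥ u) with hm
  have hm0 : 0 < m := by simpa using hC.dotProduct_mulVec_pos hu0
  have hut : 2 * (u ⬝ᵥ (C *ᵥ t)) = m := by
    rw [hm, hu]
    simp only [mulVec_sub, dotProduct_sub, sub_dotProduct]
    rw [hcomm t s, hst]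
    ring
  set w := C *ᵥ u with hw
  have hwu : u ᵥ* C = w := by rw [hw, ← mulVec_transpose, hsymm]
  -- The transpose of this matrix is the reflection, for the inner product given by `C`, in the
  -- hyperplane orthogonal to `u = t - s`. It exchanges `t` and `s` because they have the same
  -- length.
  refine ⟨1 - (2 / m) • vecMulVec w u, ?_, ?_⟩
  · have hQt : (1 - (2 / m) • vecMulVec w u)ᵀ = 1 - (2 / m) • vecMulVec u w := by
      rw [transpose_sub, transpose_one, transpose_smul, transpose_vecMulVec]
    have e1 : C * vecMulVec u w = vecMulVec w w := by
      rw [mul_vecMulVec]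
    have e2 : vecMulVec w u * C = vecMulVec w w := by
      rw [vecMulVec_mul, hwu]
    have e3 : vecMulVec w w * (1 - (2 / m) • vecMulVec u w) = - vecMulVec w w := by
      rw [mul_sub, mul_one, mul_smul_comm, vecMulVec_mul_vecMulVec, dotProduct_comm w u, ← hm]
      ext a b
      simp [vecMulVec_apply]
      field_simp
      ring
    rw [hQt, sub_mul, one_mul, smul_mul_assoc, e2, sub_mul, mul_sub, mul_one, mul_smul_comm, e1,
      smul_mul_assoc, e3]
    module
  · rw [transpose_sub, transpose_one, transpose_smul, transpose_vecMulVec, sub_mulVec,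
      one_mulVec, smul_mulVec, vecMulVec_mulVec]
    have : w ⬝ᵥ t = m / 2 := by
      rw [← hut, dotProduct_comm, hw, hcomm]; ring
    rw [this]
    ext a
    simp [hu]
    field_simp
    ring

/-- The integrand of the averaging argument. -/
noncomputable def volExp (S : Matrix κ κ ℝ) (t : κ → ℝ) : ENNReal :=
  ENNReal.ofReal √S.det * ENNReal.ofReal (Real.exp (-(t ⬝ᵥ (S *ᵥ t)) / 2))

theorem measurable_volExp {N : ℕ} :
    Measurable fun p : (κ → ℝ) × (Fin N → κ → ℝ) => volExp (sampleCovMatrix p.2) p.1 := by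
  have h : Continuous fun p : (κ → ℝ) × (Fin N → κ → ℝ) => sampleCovMatrix p.2 :=
    sampleCovMatrix_continuous.comp continuous_snd
  have h1 : Continuous fun p : (κ → ℝ) × (Fin N → κ → ℝ) => √(sampleCovMatrix p.2).det :=
    h.matrix_det.sqrt
  have h2 : Continuous fun p : (κ → ℝ) × (Fin N → κ → ℝ) =>
      Real.exp (-(p.1 ⬝ᵥ (sampleCovMatrix p.2 *ᵥ p.1)) / 2) :=
    Real.continuous_exp.comp
      ((continuous_fst.dotProduct (h.matrix_mulVec continuous_fst)).neg.div_const 2)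
  exact h1.measurable.ennreal_ofReal.mul h2.measurable.ennreal_ofReal

theorem measurable_volExp_left {N : ℕ} (t : κ → ℝ) :
    Measurable fun z : Fin N → κ → ℝ => volExp (sampleCovMatrix z) t := by
  have h : Measurable (Function.uncurry fun (t : κ → ℝ) (z : Fin N → κ → ℝ) =>
      volExp (sampleCovMatrix z) t) := measurable_volExp
  exact h.of_uncurry_left

/-- The expectation of `volExp` depends on `t` only through the variance of `t`. -/
theorem lintegral_volExp_congr (γ : Measure (κ → ℝ)) [IsGaussian γ]
    (hpos : (covMatrix γ).PosDef) (N : ℕ) {s t : κ → ℝ}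
    (hst : s ⬝ᵥ (covMatrix γ *ᵥ s) = t ⬝ᵥ (covMatrix γ *ᵥ t)) :
    ∫⁻ z, volExp (sampleCovMatrix z) t ∂(Measure.pi fun _ : Fin N => γ)
      = ∫⁻ z, volExp (sampleCovMatrix z) s ∂(Measure.pi fun _ : Fin N => γ) := by
  -- Applying `x ↦ Q x + k` to every sample point preserves the product measure and turns `S` into
  -- `Q S Qᵀ`. The determinant is unchanged as `Q.det ^ 2 = 1`, while in the exponent `t` becomes
  -- `Qᵀ t = s`.
  obtain ⟨Q, hQ, hQt⟩ := exists_reflection hpos hst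
  obtain ⟨k, hk⟩ := map_affine_eq_self γ hQ
  have hdetQ : Q.det ^ 2 = 1 := by
    have h := congrArg det hQ
    rw [det_mul, det_mul, det_transpose] at h
    have h0 := hpos.det_pos.ne'
    have : (Q.det ^ 2 - 1) * (covMatrix γ).det = 0 := by linarith
    have := (mul_eq_zero.1 this).resolve_right h0
    linarith
  have hmeas : Measurable fun x : κ → ℝ => Q *ᵥ x + k := by
    have : Continuous fun x : κ → ℝ => Q *ᵥ x + k :=
      (continuous_const.matrix_mulVec continuous_id).add continuous_const
    exact this.measurable
  have hmp : MeasurePreserving (fun x : κ → ℝ => Q *ᵥ x + k) γ γ := ⟨hmeas, hk⟩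
  have hmpi := measurePreserving_pi (fun _ : Fin N => γ) (fun _ : Fin N => γ) fun _ => hmp
  refine (hmpi.lintegral_comp (measurable_volExp_left t)).symm.trans (lintegral_congr fun z => ?_)
  simp only [volExp]
  rw [sampleCovMatrix_affine, det_mul, det_mul, det_transpose]
  congr 3
  · rw [mul_right_comm, ← sq, hdetQ, one_mul]
  · rw [← mulVec_mulVec, ← mulVec_mulVec, dotProduct_mulVec, ← mulVec_transpose, hQt]

/-- The double integral of `volExp` is evaluated twice: as the Gaussian constant `c` (`hL`), and,
after rotating `t` to the axis `o`, as the sought expectation times `c / √(C.det / C o o ^ q)`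
(`hR`). Since `0 < c < ∞`, the constant cancels. -/
theorem lintegral_sqrt_det_div_of_posDef (γ : Measure (κ → ℝ)) [IsGaussian γ] (o : κ)
    (hpos : (covMatrix γ).PosDef) {N : ℕ} (hN : Fintype.card κ + 1 ≤ N) :
    ∫⁻ z, ENNReal.ofReal √((sampleCovMatrix z).det / sampleCovMatrix z o o ^ Fintype.card κ)
        ∂(Measure.pi fun _ : Fin N => γ)
      = ENNReal.ofReal √((covMatrix γ).det / covMatrix γ o o ^ Fintype.card κ) := by
  set π := Measure.pi fun _ : Fin N => γ with hπ
  set C := covMatrix γ with hC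
  set q := Fintype.card κ with hq
  set c := ∫⁻ t : κ → ℝ, ENNReal.ofReal (Real.exp (-(t ⬝ᵥ t) / 2)) with hc
  have hc0 : c ≠ 0 := lintegral_exp_neg_dotProduct_ne_zero
  have hctop : c ≠ ⊤ := lintegral_exp_neg_dotProduct_ne_top
  have hae := ae_sampleCovMatrix_posDef γ hpos hN
  have hdiag : ∀ {S : Matrix κ κ ℝ}, S.PosDef → 0 < S o o := fun {S} hS => by
    exact hS.diag_pos
  have hσ : 0 < C o o := hdiag hpos
  have hdet : 0 < C.det := hpos.det_pos
  -- integrate over `t` first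
  have hL : ∫⁻ t, ∫⁻ z, volExp (sampleCovMatrix z) t ∂π = c := by
    rw [lintegral_lintegral_swap measurable_volExp.aemeasurable]
    have : ∀ᵐ z ∂π, ∫⁻ t, volExp (sampleCovMatrix z) t = c := by
      filter_upwards [hae] with z hz
      unfold volExp
      rw [lintegral_const_mul' _ _ ENNReal.ofReal_ne_top, lintegral_exp_neg_quadForm hz,
        ← mul_assoc, ← ENNReal.ofReal_mul (Real.sqrt_nonneg _),
        mul_inv_cancel₀ (Real.sqrt_pos.2 hz.det_pos).ne', ENNReal.ofReal_one, one_mul]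
    rw [lintegral_congr_ae this, lintegral_const]
    simp
  -- replace `t` by a multiple of the basis vector `e_o` with the same variance
  set r : (κ → ℝ) → ℝ := fun t => √(t ⬝ᵥ (C *ᵥ t) / C o o) with hr
  have hr2 : ∀ t, r t ^ 2 = t ⬝ᵥ (C *ᵥ t) / C o o := fun t => by
    refine Real.sq_sqrt (div_nonneg ?_ hσ.le)
    simpa using hpos.posSemidef.dotProduct_mulVec_nonneg t
  have hsingle : ∀ (S : Matrix κ κ ℝ) (x : ℝ),
      Pi.single o x ⬝ᵥ (S *ᵥ Pi.single o x) = x ^ 2 * S o o := fun S x => by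
    simp [mulVec_single]
    ring
  have hR : ∫⁻ t, ∫⁻ z, volExp (sampleCovMatrix z) t ∂π
      = (∫⁻ z, ENNReal.ofReal √((sampleCovMatrix z).det / sampleCovMatrix z o o ^ q) ∂π)
        * (ENNReal.ofReal (√(C.det / C o o ^ q))⁻¹ * c) := by
    have h1 : ∀ t, ∫⁻ z, volExp (sampleCovMatrix z) t ∂π
        = ∫⁻ z, volExp (sampleCovMatrix z) (Pi.single o (r t)) ∂π := fun t => by
      refine lintegral_volExp_congr γ hpos N ?_
      rw [hsingle, hr2, div_mul_cancel₀ _ hσ.ne']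
    rw [lintegral_congr h1]
    have hrm : Measurable r := by
      have : Continuous r := by
        refine Continuous.sqrt (Continuous.div_const ?_ _)
        exact continuous_id.dotProduct (continuous_const.matrix_mulVec continuous_id)
      exact this.measurable
    have hsm : Measurable fun t : κ → ℝ => (Pi.single o (r t) : κ → ℝ) := by
      exact (measurable_pi_iff.2 fun a => by
        by_cases h : a = o
        · subst h; simpa using hrm
        · simp [Pi.single_eq_of_ne h])
    have hjoint : AEMeasurable (Function.uncurry fun (t : κ → ℝ) (z : Fin N → κ → ℝ) =>
        volExp (sampleCovMatrix z) (Pi.single o (r t))) (volume.prod π) :=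
      (measurable_volExp.comp ((hsm.comp measurable_fst).prodMk measurable_snd)).aemeasurable
    rw [lintegral_lintegral_swap hjoint]
    have h2 : ∀ᵐ z ∂π, ∫⁻ t, volExp (sampleCovMatrix z) (Pi.single o (r t))
        = ENNReal.ofReal √((sampleCovMatrix z).det / sampleCovMatrix z o o ^ q)
          * (ENNReal.ofReal (√(C.det / C o o ^ q))⁻¹ * c) := by
      filter_upwards [hae] with z hz
      set S := sampleCovMatrix z with hS
      have hs : 0 < S o o := hdiag hz
      have hSd := hz.det_pos
      unfold volExp
      have h3 : ∀ t, Pi.single o (r t) ⬝ᵥ (S *ᵥ Pi.single o (r t))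
          = t ⬝ᵥ (((S o o / C o o) • C) *ᵥ t) := fun t => by
        rw [hsingle, hr2, smul_mulVec, dotProduct_smul, smul_eq_mul]
        ring
      simp_rw [h3]
      rw [lintegral_const_mul' _ _ ENNReal.ofReal_ne_top,
        lintegral_exp_neg_quadForm (hpos.smul (div_pos hs hσ)), ← mul_assoc, ← mul_assoc,
        ← ENNReal.ofReal_mul (Real.sqrt_nonneg _), ← ENNReal.ofReal_mul (Real.sqrt_nonneg _),
        det_smul, ← Real.sqrt_inv, ← Real.sqrt_inv, ← Real.sqrt_mul hSd.le,
        ← Real.sqrt_mul (by positivity), ← hc, ← hq]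
      congr 3
      rw [div_pow]
      field_simp
    rw [lintegral_congr_ae h2, lintegral_mul_const' _ _
      (ENNReal.mul_ne_top ENNReal.ofReal_ne_top hctop)]
  have hv : 0 < √(C.det / C o o ^ q) := Real.sqrt_pos.2 (by positivity)
  rw [hL, ← mul_assoc] at hR
  have h1 : (∫⁻ z, ENNReal.ofReal √((sampleCovMatrix z).det / sampleCovMatrix z o o ^ q) ∂π)
      * ENNReal.ofReal (√(C.det / C o o ^ q))⁻¹ = 1 := by
    have := (ENNReal.mul_left_inj hc0 hctop).1 ((one_mul c).trans hR)
    exact this.symm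
  rw [ENNReal.ofReal_inv_of_pos hv] at h1
  have := ENNReal.eq_inv_of_mul_eq_one_left h1
  rw [this, inv_inv]

/-- A null vector of the covariance matrix is a linear form of variance zero. It is almost surely
constant along the sample, so it is also a null vector of the sample covariance matrix. -/
theorem ae_det_sampleCovMatrix_eq_zero (γ : Measure (κ → ℝ)) [IsGaussian γ]
    (hdet : (covMatrix γ).det = 0) {N : ℕ} (hN : 1 ≤ N) :
    ∀ᵐ z ∂(Measure.pi fun _ : Fin N => γ), (sampleCovMatrix z).det = 0 := by
  obtain ⟨t, ht0, ht⟩ := exists_mulVec_eq_zero_iff.2 hdet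
  have hvar : Var[fun x => t ⬝ᵥ x; γ] = 0 := by rw [variance_dotProduct, ht, dotProduct_zero]
  have hmem : MemLp (fun x => t ⬝ᵥ x) 2 γ := by
    unfold dotProduct
    exact memLp_finsetSum _ fun a _ => (memLp_eval_of_isGaussian γ a).const_mul _
  have hconst : ∀ᵐ x ∂γ, t ⬝ᵥ x = ∫ x, t ⬝ᵥ x ∂γ :=
    ae_eq_integral_of_variance_eq_zero hmem hvar
  have hall : ∀ᵐ z ∂(Measure.pi fun _ : Fin N => γ), ∀ i, t ⬝ᵥ z i = ∫ x, t ⬝ᵥ x ∂γ :=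
    ae_all_iff.2 fun i =>
      (measurePreserving_eval (fun _ : Fin N => γ) i).quasiMeasurePreserving.ae hconst
  filter_upwards [hall] with z hz
  refine exists_mulVec_eq_zero_iff.1 ⟨t, ht0, ?_⟩
  rw [← (sampleCovMatrix_posSemidef hN z).dotProduct_mulVec_zero_iff, star_trivial,
    ← sampleCov_dotProduct]
  exact sampleCov_self_of_const fun i j => by rw [hz, hz]

/-- For a Gaussian sample, `√(det S / S_{oo}^q)` is an unbiased estimator. -/
theorem lintegral_sqrt_det_div (γ : Measure (κ → ℝ)) [IsGaussian γ] (o : κ)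
    {N : ℕ} (hN : Fintype.card κ + 1 ≤ N) :
    ∫⁻ z, ENNReal.ofReal √((sampleCovMatrix z).det / sampleCovMatrix z o o ^ Fintype.card κ)
        ∂(Measure.pi fun _ : Fin N => γ)
      = ENNReal.ofReal √((covMatrix γ).det / covMatrix γ o o ^ Fintype.card κ) := by
  by_cases hdet : (covMatrix γ).det = 0
  · have h : ∀ᵐ z ∂(Measure.pi fun _ : Fin N => γ), ENNReal.ofReal
        √((sampleCovMatrix z).det / sampleCovMatrix z o o ^ Fintype.card κ) = 0 := by
      filter_upwards [ae_det_sampleCovMatrix_eq_zero γ hdet (N := N) (by omega)] with z hz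
      simp [hz]
    rw [lintegral_congr_ae h, hdet]
    simp
  · refine lintegral_sqrt_det_div_of_posDef γ o ?_ hN
    rw [(covMatrix_posSemidef γ).posDef_iff_isUnit, isUnit_iff_isUnit_det]
    exact isUnit_iff_ne_zero.2 hdet

end Unbiased

end SuRF

namespace SuRF

/-! ### Riemann sums over unions of boxes -/

section RiemannSums

variable {ι : Type*}

/-- The closed box with centre `b` and side lengths `δ`. -/
def closedBox (δ b : ι → ℝ) : Set (ι → ℝ) := {y | ∀ i, |y i - b i| ≤ δ i / 2}

/-- The open box with centre `b` and side lengths `δ`. -/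
def openBox (δ b : ι → ℝ) : Set (ι → ℝ) := {y | ∀ i, |y i - b i| < δ i / 2}

/-- The grid through `b` that divides each side of the box into `n` pieces. -/
def boxGrid (δ b : ι → ℝ) (n : ℕ) : Set (ι → ℝ) :=
  {y | ∃ z : ι → ℤ, ∀ i, y i = b i + δ i / (n : ℝ) * (z i : ℝ)}

theorem closedBox_eq_Icc (δ b : ι → ℝ) :
    closedBox δ b = Set.Icc (fun i => b i - δ i / 2) (fun i => b i + δ i / 2) := by
  ext y
  simp only [closedBox, Set.mem_ofPred_eq, Set.mem_Icc, Pi.le_def, abs_le, ← forall_and]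
  refine forall_congr' fun i => ?_
  constructor <;> rintro ⟨h1, h2⟩ <;> constructor <;> linarith

theorem openBox_eq_pi (δ b : ι → ℝ) :
    openBox δ b = Set.univ.pi fun i => Set.Ioo (b i - δ i / 2) (b i + δ i / 2) := by
  ext y
  simp only [openBox, Set.mem_ofPred_eq, Set.mem_univ_pi, Set.mem_Ioo, abs_lt]
  refine forall_congr' fun i => ?_
  constructor <;> rintro ⟨h1, h2⟩ <;> constructor <;> linarith

theorem openBox_subset_closedBox (δ b : ι → ℝ) : openBox δ b ⊆ closedBox δ b :=
  fun _ hy i => (hy i).le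

theorem isCompact_closedBox (δ b : ι → ℝ) : IsCompact (closedBox δ b) := by
  rw [closedBox_eq_Icc, ← Set.pi_univ_Icc]
  exact isCompact_univ_pi fun i => isCompact_Icc

theorem isClosed_closedBox (δ b : ι → ℝ) : IsClosed (closedBox δ b) :=
  (isCompact_closedBox δ b).isClosed

variable [Fintype ι]

theorem isOpen_openBox (δ b : ι → ℝ) : IsOpen (openBox δ b) := by
  rw [openBox_eq_pi]
  exact isOpen_set_pi Set.finite_univ fun i _ => isOpen_Ioo

theorem openBox_ae_eq_closedBox (δ b : ι → ℝ) :
    openBox δ b =ᵐ[volume] closedBox δ b := by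
  rw [openBox_eq_pi, closedBox_eq_Icc]
  exact Measure.univ_pi_Ioo_ae_eq_Icc

/-- A set between an open box and its closure, or within the boundary of the box, has a null
frontier. -/
theorem volume_frontier_eq_zero {δ b : ι → ℝ} {s : Set (ι → ℝ)} (hs : s ⊆ closedBox δ b)
    (h : openBox δ b ⊆ s ∨ Disjoint (openBox δ b) s) : volume (frontier s) = 0 := by
  have hcl : closure s ⊆ closedBox δ b := closure_minimal hs (isClosed_closedBox δ b)
  have hsub : frontier s ⊆ closedBox δ b \ openBox δ b := by
    rcases h with h | h
    · exact Set.sdiff_subset_sdiff hcl (interior_maximal h (isOpen_openBox δ b))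
    · refine fun y hy => ⟨hcl hy.1, fun hyo => ?_⟩
      exact Set.disjoint_left.1 (h.closure_right (isOpen_openBox δ b)) hyo hy.1
  exact measure_mono_null hsub (ae_le_set.1 (openBox_ae_eq_closedBox δ b).symm.le)

theorem finite_closedBox_inter_boxGrid {δ : ι → ℝ} (hδ : ∀ i, 0 < δ i) (b : ι → ℝ) {n : ℕ}
    (hn : 0 < n) : (closedBox δ b ∩ boxGrid δ b n).Finite := by
  have hfin : (Set.univ.pi fun _ : ι => Set.Icc (-(n : ℤ)) n).Finite :=
    Set.Finite.pi fun _ => Set.finite_Icc _ _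
  refine (hfin.image fun (z : ι → ℤ) i => b i + δ i / (n : ℝ) * (z i : ℝ)).subset ?_
  rintro y ⟨hy, z, hz⟩
  have hn' : (0 : ℝ) < n := by exact_mod_cast hn
  refine ⟨z, fun i _ => ?_, (funext hz).symm⟩
  have h1 := hy i
  rw [hz i, add_sub_cancel_left, abs_mul, abs_of_pos (div_pos (hδ i) hn')] at h1
  have h2 : |(z i : ℝ)| ≤ n := by
    have h3 : δ i / n * |(z i : ℝ)| ≤ δ i / n * n := by
      rw [div_mul_cancel₀ _ hn'.ne']
      linarith [hδ i]
    exact le_of_mul_le_mul_left h3 (div_pos (hδ i) hn')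
  rw [abs_le] at h2
  exact ⟨by exact_mod_cast h2.1, by exact_mod_cast h2.2⟩

/-- The affine map sending the unit box to the box with centre `b` and side lengths `δ`. -/
def boxMap (δ b u : ι → ℝ) : ι → ℝ := fun i => b i + δ i * u i

omit [Fintype ι] in
theorem continuous_boxMap (δ b : ι → ℝ) : Continuous (boxMap δ b) := by
  unfold boxMap
  fun_prop

/-- `boxMap` as a homeomorphism. -/
noncomputable def boxHomeo {δ : ι → ℝ} (hδ : ∀ i, 0 < δ i) (b : ι → ℝ) :
    (ι → ℝ) ≃ₜ (ι → ℝ) where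
  toFun := boxMap δ b
  invFun y := fun i => (y i - b i) / δ i
  left_inv u := by
    ext i
    simp [boxMap, (hδ i).ne']
  right_inv y := by
    ext i
    have := (hδ i).ne'
    simp only [boxMap]
    field_simp
    ring
  continuous_toFun := continuous_boxMap δ b
  continuous_invFun := by fun_prop

theorem smul_map_boxMap_volume {δ : ι → ℝ} (hδ : ∀ i, 0 < δ i) (b : ι → ℝ) :
    ENNReal.ofReal (∏ i, δ i) • Measure.map (boxMap δ b) volume = volume := by
  classical
  have hpos : 0 < ∏ i, δ i := Finset.prod_pos fun i _ => hδ i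
  have h1 : boxMap δ b = (fun x => b + x) ∘ (Matrix.toLin' (Matrix.diagonal δ)) := by
    ext u i
    simp [boxMap, Matrix.mulVec_diagonal]
  have h2 := Real.smul_map_diagonal_volume_pi (D := δ)
    (by rw [Matrix.det_diagonal]; exact hpos.ne')
  rw [Matrix.det_diagonal, abs_of_pos hpos] at h2
  rw [h1, ← Measure.map_map (by fun_prop)
    (LinearMap.continuous_of_finiteDimensional _).measurable, ← Measure.map_smul, h2,
    map_add_left_eq_self]

-- An affine change of variables turns the grid into `n⁻¹ ℤ^ι`, where lattice Riemann sums converge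
-- for continuous integrands on bounded sets with null frontier. Clamping the coordinates to the box
-- extends `f` continuously to the whole space without changing it on `s`.
open scoped Pointwise in
theorem tendsto_riemannSum_box {δ : ι → ℝ} (hδ : ∀ i, 0 < δ i) (b : ι → ℝ)
    {s : Set (ι → ℝ)} (hs : s ⊆ closedBox δ b) (hsm : MeasurableSet s)
    (h : openBox δ b ⊆ s ∨ Disjoint (openBox δ b) s)
    {f : (ι → ℝ) → ℝ} (hf : ContinuousOn f (closedBox δ b)) :
    Tendsto (fun n : ℕ => ∑ᶠ y ∈ s ∩ boxGrid δ b n, f y * ∏ i, δ i / (n : ℝ)) atTop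
      (𝓝 (∫ y in s, f y)) := by
  classical
  set φ := boxHomeo hδ b with hφ
  have hφa : ∀ u i, φ u i = b i + δ i * u i := fun u i => rfl
  -- a continuous extension of `f`
  set cl : (ι → ℝ) → (ι → ℝ) := fun y i => max (b i - δ i / 2) (min (y i) (b i + δ i / 2))
    with hcl
  have hclc : Continuous cl := by rw [hcl]; fun_prop
  have hclm : ∀ y, cl y ∈ closedBox δ b := fun y => by
    rw [closedBox_eq_Icc]
    refine ⟨fun i => le_max_left _ _, fun i => max_le ?_ (min_le_right _ _)⟩
    have := hδ i
    show b i - δ i / 2 ≤ b i + δ i / 2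
    linarith
  have hcle : ∀ y ∈ closedBox δ b, cl y = y := fun y hy => by
    rw [closedBox_eq_Icc] at hy
    ext i
    simp only [hcl]
    rw [min_eq_left (hy.2 i), max_eq_right (hy.1 i)]
  have hFc : Continuous fun u => f (cl (φ u)) :=
    hf.comp_continuous (hclc.comp φ.continuous) fun u => hclm _
  have hbdd : Bornology.IsBounded (φ ⁻¹' s) := by
    have h1 : IsCompact (φ ⁻¹' closedBox δ b) :=
      φ.isCompact_preimage.2 (isCompact_closedBox δ b)
    exact h1.isBounded.subset (Set.preimage_mono hs)
  have hmap := smul_map_boxMap_volume hδ b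
  have hpos : 0 < ∏ i, δ i := Finset.prod_pos fun i _ => hδ i
  have hmeas : Measurable (boxMap δ b) := (continuous_boxMap δ b).measurable
  have hfr : volume (frontier (φ ⁻¹' s)) = 0 := by
    rw [← φ.preimage_frontier]
    have h1 := volume_frontier_eq_zero hs h
    rw [← hmap, Measure.smul_apply, smul_eq_mul, mul_eq_zero] at h1
    rcases h1 with h1 | h1
    · exact absurd h1 (by simpa using hpos)
    · rwa [Measure.map_apply hmeas measurableSet_frontier] at h1
  have hlim := (tendsto_tsum_div_pow_atTop_integral (φ ⁻¹' s) _ hFc hbdd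
    (hsm.preimage φ.continuous.measurable) hfr).const_mul (∏ i, δ i)
  have hint : (∏ i, δ i) * ∫ u in φ ⁻¹' s, f (cl (φ u)) = ∫ y in s, f y := by
    rw [setIntegral_congr_fun hsm (g := fun y => f (cl y))
      fun y hy => by simp only; rw [hcle y (hs hy)]]
    conv_rhs => rw [← hmap]
    rw [Measure.restrict_smul, integral_smul_measure, ENNReal.toReal_ofReal hpos.le, smul_eq_mul]
    congr 1
    exact (φ.measurableEmbedding.setIntegral_map (μ := volume) (fun y => f (cl y)) s).symm
  rw [hint] at hlim
  refine hlim.congr' ?_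
  filter_upwards [eventually_ge_atTop 1] with n hn
  have : NeZero n := ⟨by omega⟩
  have hn0 : (n : ℝ) ≠ 0 := by positivity
  rw [tsum_subtype _ fun u => f (cl (φ u))]
  set G := φ ⁻¹' s ∩ ((n : ℝ)⁻¹ • (Submodule.span ℤ (Set.range (Pi.basisFun ℝ ι)) :
    Set (ι → ℝ))) with hG
  have hGmem : ∀ u, u ∈ G ↔ φ u ∈ s ∩ boxGrid δ b n := by
    intro u
    have h1 : u ∈ ((n : ℝ)⁻¹ • (Submodule.span ℤ (Set.range (Pi.basisFun ℝ ι)) :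
        Set (ι → ℝ))) ↔ φ u ∈ boxGrid δ b n := by
      have h2 := BoxIntegral.unitPartition.mem_smul_span_iff (n := n) (v := u)
      have h3 : u ∈ ((n : ℝ)⁻¹ • (Submodule.span ℤ (Set.range (Pi.basisFun ℝ ι)) :
        Set (ι → ℝ))) ↔ u ∈ (n : ℝ)⁻¹ • Submodule.span ℤ (Set.range (Pi.basisFun ℝ ι)) :=
        Iff.rfl
      rw [h3, h2]
      simp only [Set.mem_range, algebraMap_int_eq, eq_intCast, boxGrid, Set.mem_ofPred_eq, hφa]
      rw [← Classical.skolem (p := fun i (z : ℤ) => b i + δ i * u i = b i + δ i / n * (z : ℝ))]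
      refine forall_congr' fun i => exists_congr fun z => ?_
      have := (hδ i).ne'
      constructor
      · intro hz; rw [hz]; field_simp
      · intro hz
        have : δ i * u i = δ i / n * z := by linarith
        field_simp at this
        linarith
    rw [hG, Set.mem_inter_iff, h1]
    rfl
  have hfin : G.Finite :=
    ((finite_closedBox_inter_boxGrid hδ b (by omega)).preimage φ.injective.injOn).subset
      fun u hu => ⟨hs ((hGmem u).1 hu).1, ((hGmem u).1 hu).2⟩
  rw [tsum_eq_finsum (hfin.subset (Set.support_indicator_subset)), ← finsum_mem_def]
  have hprod : ∏ i, δ i / (n : ℝ) = (∏ i, δ i) / (n : ℝ) ^ Fintype.card ι := by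
    rw [Finset.prod_div_distrib]; simp
  rw [hprod, mul_div_left_comm, finsum_mem_mul]
  refine finsum_mem_eq_of_bijOn φ ⟨fun u hu => (hGmem u).1 hu, φ.injective.injOn,
    fun y hy => ⟨φ.symm y, (hGmem _).2 (by simpa using hy), by simp⟩⟩ fun u hu => ?_
  rw [hcle _ (hs ((hGmem u).1 hu).1)]

/-- The geometry of the union of boxes with side lengths `δ` and centres in `E`: the set `F` is
covered by the closed boxes, which do not overlap, and `F` contains or avoids each open box. -/
structure IsBoxUnion (δ : ι → ℝ) (E : Finset (ι → ℝ)) (F : Set (ι → ℝ)) : Prop where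
  side_pos : ∀ i, 0 < δ i
  separated : ∀ b ∈ E, ∀ b' ∈ E, b ≠ b' → ∃ i, δ i ≤ |b i - b' i|
  measurableSet : MeasurableSet F
  subset : F ⊆ ⋃ b ∈ E, closedBox δ b
  openBox_subset_or_disjoint : ∀ b ∈ E, openBox δ b ⊆ F ∨ Disjoint (openBox δ b) F

omit [Fintype ι] in
theorem IsBoxUnion.disjoint_openBox {δ : ι → ℝ} {E : Finset (ι → ℝ)} {F : Set (ι → ℝ)}
    (h : IsBoxUnion δ E F) {b b' : ι → ℝ} (hb : b ∈ E) (hb' : b' ∈ E) (hne : b ≠ b') :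
    Disjoint (openBox δ b) (openBox δ b') := by
  obtain ⟨i, hi⟩ := h.separated b hb b' hb' hne
  refine Set.disjoint_left.2 fun y hy hy' => ?_
  have h1 := abs_lt.1 (hy i)
  have h2 := abs_lt.1 (hy' i)
  rcases le_abs.1 hi with h3 | h3 <;> linarith

/-- Closed boxes may share boundary points, but the open boxes are disjoint and differ from them by
null sets. -/
theorem IsBoxUnion.setIntegral_eq {δ : ι → ℝ} {E : Finset (ι → ℝ)} {F : Set (ι → ℝ)}
    (h : IsBoxUnion δ E F) {f : (ι → ℝ) → ℝ}
    (hf : ∀ b ∈ E, IntegrableOn f (F ∩ closedBox δ b)) :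
    ∫ y in F, f y = ∑ b ∈ E, ∫ y in F ∩ closedBox δ b, f y := by
  have hae : ∀ b, (F ∩ openBox δ b : Set (ι → ℝ)) =ᵐ[volume] (F ∩ closedBox δ b : Set (ι → ℝ)) :=
    fun b => (ae_eq_refl F).inter (openBox_ae_eq_closedBox δ b)
  have h1 : (⋃ b ∈ E, F ∩ openBox δ b : Set (ι → ℝ)) =ᵐ[volume] F := by
    have h2 : (⋃ b ∈ E, F ∩ openBox δ b : Set (ι → ℝ))
        =ᵐ[volume] (⋃ b ∈ E, F ∩ closedBox δ b : Set (ι → ℝ)) :=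
      Filter.EventuallyEq.countable_bUnion E.countable_toSet fun b _ => hae b
    have h3 : (⋃ b ∈ E, F ∩ closedBox δ b : Set (ι → ℝ)) = F := by
      rw [← Set.inter_iUnion₂, Set.inter_eq_left.2 h.subset]
    rwa [h3] at h2
  rw [← setIntegral_congr_set h1, integral_biUnion_finset]
  · exact Finset.sum_congr rfl fun b _ => setIntegral_congr_set (hae b)
  · exact fun b _ => h.measurableSet.inter (isOpen_openBox δ b).measurableSet
  · intro b hb b' hb' hne
    exact (h.disjoint_openBox hb hb' hne).mono Set.inter_subset_right Set.inter_subset_right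
  · exact fun b hb => (hf b hb).mono_set
      (Set.inter_subset_inter_right _ (openBox_subset_closedBox δ b))

theorem IsBoxUnion.finite_inter_grid {δ : ι → ℝ} {E : Finset (ι → ℝ)} {F : Set (ι → ℝ)}
    (h : IsBoxUnion δ E F) {n : ℕ} (hn : 0 < n) :
    (F ∩ ⋃ b ∈ E, closedBox δ b ∩ boxGrid δ b n).Finite :=
  (E.finite_toSet.biUnion fun b _ =>
    finite_closedBox_inter_boxGrid h.side_pos b hn).subset Set.inter_subset_right

omit [Fintype ι] in
theorem sum_biUnion_le_of_nonneg {α β : Type*} [DecidableEq β] (s : Finset α) (t : α → Finset β)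
    {f : β → ℝ} (hf : ∀ x, 0 ≤ f x) :
    ∑ x ∈ s.biUnion t, f x ≤ ∑ a ∈ s, ∑ x ∈ t a, f x := by
  classical
  induction s using Finset.induction_on with
  | empty => simp
  | insert a s ha ih =>
    rw [Finset.biUnion_insert, Finset.sum_insert ha]
    have := Finset.sum_union_inter (s₁ := t a) (s₂ := s.biUnion t) (f := f)
    have h0 : 0 ≤ ∑ x ∈ t a ∩ s.biUnion t, f x := Finset.sum_nonneg fun x _ => hf x
    linarith

/-- Riemann sums of a nonnegative function over a union of boxes, in which the points on common
faces are counted only once. -/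
theorem IsBoxUnion.tendsto_riemannSum {δ : ι → ℝ} {E : Finset (ι → ℝ)} {F : Set (ι → ℝ)}
    (h : IsBoxUnion δ E F) {f : (ι → ℝ) → ℝ} (hf0 : ∀ y, 0 ≤ f y)
    (hf : ∀ b ∈ E, ContinuousOn f (closedBox δ b)) :
    Tendsto (fun n : ℕ => ∑ᶠ y ∈ F ∩ ⋃ b ∈ E, closedBox δ b ∩ boxGrid δ b n,
        f y * ∏ i, δ i / (n : ℝ)) atTop (𝓝 (∫ y in F, f y)) := by
  classical
  have hint : ∀ b ∈ E, IntegrableOn f (F ∩ closedBox δ b) := fun b hb =>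
    ((hf b hb).integrableOn_compact (isCompact_closedBox δ b)).mono_set Set.inter_subset_right
  have hae : ∀ b, (F ∩ openBox δ b : Set (ι → ℝ)) =ᵐ[volume] (F ∩ closedBox δ b : Set (ι → ℝ)) :=
    fun b => (ae_eq_refl F).inter (openBox_ae_eq_closedBox δ b)
  -- Squeeze: since `f` is nonnegative, the sum lies between the total over the disjoint open boxes,
  -- which omits the boundaries, and the total over the closed boxes, which counts common points
  -- repeatedly. Both totals have the same limit.
  have hlow : ∀ b ∈ E, Tendsto (fun n : ℕ => ∑ᶠ y ∈ (F ∩ openBox δ b) ∩ boxGrid δ b n,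
      f y * ∏ i, δ i / (n : ℝ)) atTop (𝓝 (∫ y in F ∩ closedBox δ b, f y)) := by
    intro b hb
    rw [← setIntegral_congr_set (hae b)]
    refine tendsto_riemannSum_box h.side_pos b
      (Set.inter_subset_right.trans (openBox_subset_closedBox δ b))
      (h.measurableSet.inter (isOpen_openBox δ b).measurableSet) ?_ (hf b hb)
    rcases h.openBox_subset_or_disjoint b hb with h1 | h1
    · exact Or.inl fun y hy => ⟨h1 hy, hy⟩
    · exact Or.inr (h1.mono_right Set.inter_subset_left)
  have hup : ∀ b ∈ E, Tendsto (fun n : ℕ => ∑ᶠ y ∈ (F ∩ closedBox δ b) ∩ boxGrid δ b n,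
      f y * ∏ i, δ i / (n : ℝ)) atTop (𝓝 (∫ y in F ∩ closedBox δ b, f y)) := by
    intro b hb
    refine tendsto_riemannSum_box h.side_pos b Set.inter_subset_right
      (h.measurableSet.inter (isClosed_closedBox δ b).measurableSet) ?_ (hf b hb)
    rcases h.openBox_subset_or_disjoint b hb with h1 | h1
    · exact Or.inl fun y hy => ⟨h1 hy, openBox_subset_closedBox δ b hy⟩
    · exact Or.inr (h1.mono_right Set.inter_subset_left)
  rw [h.setIntegral_eq hint]
  refine tendsto_of_tendsto_of_tendsto_of_le_of_le' (tendsto_finsetSum E hlow)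
    (tendsto_finsetSum E hup) ?_ ?_
  · filter_upwards [eventually_gt_atTop 0] with n hn
    have hw : ∀ y, 0 ≤ f y * ∏ i, δ i / (n : ℝ) := fun y => mul_nonneg (hf0 y)
      (Finset.prod_nonneg fun i _ => div_nonneg (h.side_pos i).le (Nat.cast_nonneg n))
    have hfin := h.finite_inter_grid hn
    have hfin' : ∀ b, ((F ∩ openBox δ b) ∩ boxGrid δ b n).Finite := fun b =>
      (finite_closedBox_inter_boxGrid h.side_pos b hn).subset fun y hy =>
        ⟨openBox_subset_closedBox δ b hy.1.2, hy.2⟩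
    rw [finsum_mem_eq_finite_toFinset_sum _ hfin,
      Finset.sum_congr rfl fun b _ => finsum_mem_eq_finite_toFinset_sum _ (hfin' b),
      ← Finset.sum_biUnion]
    · refine Finset.sum_le_sum_of_subset_of_nonneg (fun y hy => ?_) fun y _ _ => hw y
      simp only [Finset.mem_biUnion, Set.Finite.mem_toFinset] at hy
      obtain ⟨b, hb, ⟨hyF, hyo⟩, hyg⟩ := hy
      rw [Set.Finite.mem_toFinset]
      exact ⟨hyF, Set.mem_biUnion hb ⟨openBox_subset_closedBox δ b hyo, hyg⟩⟩
    · intro b hb b' hb' hne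
      rw [Function.onFun, Finset.disjoint_left]
      intro y hy hy'
      rw [Set.Finite.mem_toFinset] at hy hy'
      exact Set.disjoint_left.1 (h.disjoint_openBox hb hb' hne) hy.1.2 hy'.1.2
  · filter_upwards [eventually_gt_atTop 0] with n hn
    have hw : ∀ y, 0 ≤ f y * ∏ i, δ i / (n : ℝ) := fun y => mul_nonneg (hf0 y)
      (Finset.prod_nonneg fun i _ => div_nonneg (h.side_pos i).le (Nat.cast_nonneg n))
    have hfin := h.finite_inter_grid hn
    have hfin' : ∀ b, ((F ∩ closedBox δ b) ∩ boxGrid δ b n).Finite := fun b =>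
      (finite_closedBox_inter_boxGrid h.side_pos b hn).subset fun y hy => ⟨hy.1.2, hy.2⟩
    rw [finsum_mem_eq_finite_toFinset_sum _ hfin,
      Finset.sum_congr rfl fun b _ => finsum_mem_eq_finite_toFinset_sum _ (hfin' b)]
    refine le_trans ?_ (sum_biUnion_le_of_nonneg E _ hw)
    refine Finset.sum_le_sum_of_subset_of_nonneg (fun y hy => ?_) fun y _ _ => hw y
    rw [Set.Finite.mem_toFinset] at hy
    obtain ⟨hyF, hyU⟩ := hy
    obtain ⟨b, hb, hyc, hyg⟩ := Set.mem_iUnion₂.1 hyU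
    simp only [Finset.mem_biUnion, Set.Finite.mem_toFinset]
    exact ⟨b, hb, ⟨hyF, hyc⟩, hyg⟩

end RiemannSums

end SuRF

namespace SuRF

open Matrix

/-! ### The sample variance of a smooth Gaussian field has no zeros -/

section NoZeros

theorem gaussianReal_Icc_le {m : ℝ} {v : NNReal} {s : ℝ} (hs : 0 < s) (hv : s ≤ v) (a η : ℝ) :
    gaussianReal m v (Set.Icc (a - η) (a + η))
      ≤ ENNReal.ofReal ((√(2 * Real.pi * s))⁻¹ * (2 * η)) := by
  have hv0 : v ≠ 0 := by
    rintro rfl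
    simp only [NNReal.coe_zero] at hv
    linarith
  have hc : 0 < √(2 * Real.pi * s) := Real.sqrt_pos.2 (by positivity)
  have hpdf : ∀ x, gaussianPDF m v x ≤ ENNReal.ofReal (√(2 * Real.pi * s))⁻¹ := fun x => by
    refine ENNReal.ofReal_le_ofReal ?_
    unfold gaussianPDFReal
    refine (mul_le_of_le_one_right (by positivity) ?_).trans ?_
    · rw [Real.exp_le_one_iff]
      exact div_nonpos_of_nonpos_of_nonneg (neg_nonpos.2 (sq_nonneg _)) (by positivity)
    · gcongr
  rw [gaussianReal_apply m hv0]
  calc ∫⁻ x in Set.Icc (a - η) (a + η), gaussianPDF m v x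
      ≤ ∫⁻ x in Set.Icc (a - η) (a + η), ENNReal.ofReal (√(2 * Real.pi * s))⁻¹ :=
        lintegral_mono hpdf
    _ = _ := by
      rw [setLIntegral_const, Real.volume_Icc, ← ENNReal.ofReal_mul (by positivity)]
      congr 2
      ring

/-- Given coordinate `0`, the other `n` coordinates independently fall into an interval of length `2
* η` around it. The exponent `n` counts the degrees of freedom, and the bound is uniform over
variances at least `s`. -/
theorem pi_gaussianReal_close_le {m : ℝ} {v : NNReal} {s : ℝ} (hs : 0 < s) (hv : s ≤ v) (η : ℝ)
    (n : ℕ) :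
    (Measure.pi fun _ : Fin (n + 1) => gaussianReal m v) {u | ∀ i j, |u i - u j| ≤ η}
      ≤ ENNReal.ofReal ((√(2 * Real.pi * s))⁻¹ * (2 * η)) ^ n := by
  have hmp := measurePreserving_piFinSuccAbove (fun _ : Fin (n + 1) => gaussianReal m v) 0
  set A : Set (ℝ × (Fin n → ℝ)) := {p | ∀ i, |p.2 i - p.1| ≤ η} with hA
  have hAm : MeasurableSet A := by
    have : A = ⋂ i, {p : ℝ × (Fin n → ℝ) | |p.2 i - p.1| ≤ η} := by
      ext p; simp [hA]
    rw [this]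
    refine MeasurableSet.iInter fun i => ?_
    exact (isClosed_le (by fun_prop) continuous_const).measurableSet
  have hsub : {u : Fin (n + 1) → ℝ | ∀ i j, |u i - u j| ≤ η}
      ⊆ (MeasurableEquiv.piFinSuccAbove (fun _ => ℝ) 0) ⁻¹' A := fun u hu i => hu _ _
  refine (measure_mono hsub).trans ?_
  rw [hmp.measure_preimage hAm.nullMeasurableSet, Measure.prod_apply hAm]
  have h1 : ∀ a : ℝ, (Measure.pi fun _ : Fin n => gaussianReal m v) (Prod.mk a ⁻¹' A)
      ≤ ENNReal.ofReal ((√(2 * Real.pi * s))⁻¹ * (2 * η)) ^ n := fun a => by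
    have : Prod.mk a ⁻¹' A = Set.univ.pi fun _ : Fin n => Set.Icc (a - η) (a + η) := by
      ext u
      simp only [hA, Set.mem_preimage, Set.mem_ofPred_eq, Set.mem_univ_pi, Set.mem_Icc, abs_le]
      refine forall_congr' fun i => ?_
      constructor <;> rintro ⟨h1, h2⟩ <;> constructor <;> linarith
    rw [this, Measure.pi_pi]
    refine (Finset.prod_le_prod' fun i _ => gaussianReal_Icc_le hs hv a η).trans ?_
    simp
  refine (lintegral_mono h1).trans ?_
  simp

variable {V : Type*} [Fintype V]

theorem map_dotProduct_eq_gaussianReal (γ : Measure (V → ℝ)) [IsGaussian γ] (c : V → ℝ) :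
    ∃ m, γ.map (fun x => c ⬝ᵥ x) = gaussianReal m (Var[fun x => c ⬝ᵥ x; γ]).toNNReal := by
  set L : StrongDual ℝ (V → ℝ) := ∑ v, c v • ContinuousLinearMap.proj v with hL
  have h1 : (L : (V → ℝ) → ℝ) = fun x => c ⬝ᵥ x := by
    ext x; simp [hL, dotProduct]
  have := IsGaussian.map_eq_gaussianReal (μ := γ) L
  rw [h1] at this
  exact ⟨_, this⟩

theorem pi_dotProduct_close_le (γ : Measure (V → ℝ)) [IsGaussian γ] (c : V → ℝ) {s : ℝ}
    (hs : 0 < s) (hc : s ≤ Var[fun x => c ⬝ᵥ x; γ]) (η : ℝ) (n : ℕ) :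
    (Measure.pi fun _ : Fin (n + 1) => γ) {z | ∀ i j, |c ⬝ᵥ z i - c ⬝ᵥ z j| ≤ η}
      ≤ ENNReal.ofReal ((√(2 * Real.pi * s))⁻¹ * (2 * η)) ^ n := by
  obtain ⟨m, hm⟩ := map_dotProduct_eq_gaussianReal γ c
  have hmp : MeasurePreserving (fun x => c ⬝ᵥ x) γ
      (gaussianReal m (Var[fun x => c ⬝ᵥ x; γ]).toNNReal) :=
    ⟨(continuous_dotProduct_right c).measurable, hm⟩
  have hmpi := measurePreserving_pi (fun _ : Fin (n + 1) => γ) (fun _ : Fin (n + 1) => _)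
    fun _ => hmp
  have hcl : MeasurableSet {u : Fin (n + 1) → ℝ | ∀ i j, |u i - u j| ≤ η} := by
    have : {u : Fin (n + 1) → ℝ | ∀ i j, |u i - u j| ≤ η}
        = ⋂ i, ⋂ j, {u | |u i - u j| ≤ η} := by
      ext u; simp
    rw [this]
    exact MeasurableSet.iInter fun i => MeasurableSet.iInter fun j =>
      (isClosed_le (by fun_prop) continuous_const).measurableSet
  have h1 := hmpi.measure_preimage hcl.nullMeasurableSet
  refine le_trans (le_of_eq h1) (pi_gaussianReal_close_le hs ?_ η n)
  rwa [Real.coe_toNNReal _ (variance_nonneg _ _)]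

/-- A finite net of the closed box. -/
theorem exists_net {ι : Type*} [Fintype ι] {δ : ι → ℝ} (hδ : ∀ i, 0 < δ i) (b : ι → ℝ) {n : ℕ}
    (hn : 0 < n) :
    ∃ T : Finset (ι → ℝ), T.card ≤ (n + 1) ^ Fintype.card ι ∧ (∀ p ∈ T, p ∈ closedBox δ b) ∧
      ∀ y ∈ closedBox δ b, ∃ p ∈ T, ‖y - p‖ ≤ ‖δ‖ / n := by
  classical
  have hn' : (0 : ℝ) < n := by exact_mod_cast hn
  set φ : (ι → Fin (n + 1)) → ι → ℝ := fun z i => b i - δ i / 2 + δ i * (z i : ℕ) / n with hφ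
  refine ⟨Finset.univ.image φ, ?_, ?_, ?_⟩
  · refine Finset.card_image_le.trans ?_
    simp
  · intro p hp
    obtain ⟨z, -, rfl⟩ := Finset.mem_image.1 hp
    intro i
    have h1 : δ i * ((z i : ℕ) : ℝ) / n ≤ δ i := by
      rw [div_le_iff₀ hn']
      have : ((z i : ℕ) : ℝ) ≤ n := by exact_mod_cast Nat.lt_succ_iff.1 (z i).2
      exact mul_le_mul_of_nonneg_left this (hδ i).le
    have h2 : 0 ≤ δ i * ((z i : ℕ) : ℝ) / n :=
      div_nonneg (mul_nonneg (hδ i).le (Nat.cast_nonneg _)) hn'.le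
    rw [abs_le]
    constructor <;> simp only [hφ] <;> linarith
  · intro y hy
    set t : ι → ℝ := fun i => (y i - b i + δ i / 2) * n / δ i with ht
    have ht0 : ∀ i, 0 ≤ t i := fun i => by
      have := abs_le.1 (hy i)
      exact div_nonneg (mul_nonneg (by linarith) hn'.le) (hδ i).le
    have htn : ∀ i, t i ≤ n := fun i => by
      have := abs_le.1 (hy i)
      rw [ht, div_le_iff₀ (hδ i), mul_comm]
      exact mul_le_mul_of_nonneg_left (by linarith) hn'.le
    have hfl : ∀ i, ⌊t i⌋₊ < n + 1 := fun i =>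
      Nat.lt_succ_iff.2 (Nat.floor_le_of_le (htn i))
    refine ⟨φ fun i => ⟨⌊t i⌋₊, hfl i⟩, Finset.mem_image_of_mem _ (Finset.mem_univ _), ?_⟩
    rw [pi_norm_le_iff_of_nonneg (by positivity)]
    intro i
    have h1 : y i - φ (fun i => ⟨⌊t i⌋₊, hfl i⟩) i = δ i / n * (t i - ⌊t i⌋₊) := by
      simp only [hφ, ht]
      have := (hδ i).ne'
      field_simp
      ring
    rw [Pi.sub_apply, h1, norm_mul, Real.norm_of_nonneg (div_pos (hδ i) hn').le]
    have h2 : ‖t i - (⌊t i⌋₊ : ℝ)‖ ≤ 1 := by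
      rw [Real.norm_of_nonneg (sub_nonneg.2 (Nat.floor_le (ht0 i)))]
      linarith [Nat.lt_floor_add_one (t i)]
    have h3 : δ i ≤ ‖δ‖ := (le_abs_self _).trans (norm_le_pi_norm δ i)
    calc δ i / n * ‖t i - (⌊t i⌋₊ : ℝ)‖ ≤ δ i / n * 1 :=
          mul_le_mul_of_nonneg_left h2 (div_pos (hδ i) hn').le
      _ ≤ ‖δ‖ / n := by rw [mul_one]; gcongr

/-- Almost surely, the sample variance of a Lipschitz Gaussian field on a box has no zero, if the
number of degrees of freedom exceeds the dimension of the box. -/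
theorem ae_sampleCov_pos {ι : Type*} [Fintype ι] {δ : ι → ℝ} (hδ : ∀ i, 0 < δ i) (b : ι → ℝ)
    (γ : Measure (V → ℝ)) [IsGaussian γ] (k : (ι → ℝ) → V → ℝ) {L : ℝ} (hL : 0 ≤ L)
    (hk : ∀ y ∈ closedBox δ b, ∀ y' ∈ closedBox δ b, ∀ v, |k y v - k y' v| ≤ L * ‖y - y'‖)
    {s : ℝ} (hs : 0 < s) (hvar : ∀ y ∈ closedBox δ b, s ≤ Var[fun x => k y ⬝ᵥ x; γ])
    {N : ℕ} (hN : Fintype.card ι + 2 ≤ N) :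
    ∀ᵐ z ∂(Measure.pi fun _ : Fin N => γ), ∀ y ∈ closedBox δ b,
      0 < sampleCov (fun i => k y ⬝ᵥ z i) (fun i => k y ⬝ᵥ z i) := by
  obtain ⟨n, rfl⟩ : ∃ n, N = n + 1 := ⟨N - 1, by omega⟩
  set d := Fintype.card ι with hd
  set π := Measure.pi fun _ : Fin (n + 1) => γ with hπ
  -- The sample variance vanishes at `y` exactly when all field values there coincide. Truncating
  -- the data at level `M` makes the fields Lipschitz with constant `L * M`; countably many levels
  -- exhaust all samples.
  set bad : ℕ → Set (Fin (n + 1) → V → ℝ) := fun M =>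
    {z | (∀ i, ∑ v, |z i v| ≤ M) ∧ ∃ y ∈ closedBox δ b, ∀ i j, k y ⬝ᵥ z i = k y ⬝ᵥ z j}
    with hbad
  suffices h : ∀ M, π (bad M) = 0 by
    rw [← measure_iUnion_null_iff, measure_eq_zero_iff_ae_notMem] at h
    filter_upwards [h] with z hz y hy
    refine lt_of_le_of_ne (sampleCov_self_nonneg (by omega) _) fun h0 => hz ?_
    obtain ⟨M, hM⟩ := exists_nat_ge (∑ i, ∑ v, |z i v|)
    refine Set.mem_iUnion.2 ⟨M, fun i => le_trans ?_ hM, y, hy,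
      sampleCov_self_eq_zero (by omega) h0.symm⟩
    exact Finset.single_le_sum (f := fun i => ∑ v, |z i v|)
      (fun i _ => Finset.sum_nonneg fun v _ => abs_nonneg _) (Finset.mem_univ i)
  intro M
  -- The outer factor `2` comes from the two-sided interval, the inner one from moving both `z i`
  -- and `z j` from `y` to a net point.
  set c := (√(2 * Real.pi * s))⁻¹ * (2 * (2 * (L * ‖δ‖ * M))) with hc
  have hc0 : 0 ≤ c := by positivity
  -- A net of mesh `‖δ‖ / m` has at most `(m + 1) ^ d ≤ 2 ^ d * m ^ d` points, and near-coincidence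
  -- at each has probability at most `(c / m) ^ n`. As `n ≥ d + 1`, a factor `1 / m` survives.
  have hbound : ∀ m : ℕ, 0 < m → π (bad M) ≤ ENNReal.ofReal (2 ^ d * c ^ n / m) := by
    intro m hm
    have hm' : (0 : ℝ) < m := by exact_mod_cast hm
    obtain ⟨T, hTc, hTb, hT⟩ := exists_net hδ b hm
    have hsub : bad M ⊆ ⋃ p ∈ T,
        {z | ∀ i j, |k p ⬝ᵥ z i - k p ⬝ᵥ z j| ≤ 2 * (L * ‖δ‖ * M / m)} := by
      rintro z ⟨hzM, y, hy, hyz⟩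
      obtain ⟨p, hp, hyp⟩ := hT y hy
      refine Set.mem_iUnion₂.2 ⟨p, hp, fun i j => ?_⟩
      have h1 : ∀ i, |k p ⬝ᵥ z i - k y ⬝ᵥ z i| ≤ L * ‖δ‖ * M / m := fun i => by
        rw [← sub_dotProduct, dotProduct]
        calc |∑ v, (k p - k y) v * z i v| ≤ ∑ v, |(k p - k y) v * z i v| :=
              Finset.abs_sum_le_sum_abs _ _
          _ ≤ ∑ v, L * (‖δ‖ / m) * |z i v| := by
              refine Finset.sum_le_sum fun v _ => ?_
              rw [abs_mul]
              refine mul_le_mul_of_nonneg_right ?_ (abs_nonneg _)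
              refine (hk p (hTb p hp) y hy v).trans (mul_le_mul_of_nonneg_left ?_ hL)
              rwa [norm_sub_rev]
          _ = L * (‖δ‖ / m) * ∑ v, |z i v| := by rw [Finset.mul_sum]
          _ ≤ L * (‖δ‖ / m) * M := mul_le_mul_of_nonneg_left (hzM i) (by positivity)
          _ = _ := by ring
      have h2 := abs_le.1 (h1 i)
      have h3 := abs_le.1 (h1 j)
      have h4 := hyz i j
      rw [abs_le]
      constructor <;> linarith
    have hcm : (√(2 * Real.pi * s))⁻¹ * (2 * (2 * (L * ‖δ‖ * M / m))) = c / m := by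
      rw [hc]; ring
    calc π (bad M) ≤ ∑ p ∈ T, π {z | ∀ i j, |k p ⬝ᵥ z i - k p ⬝ᵥ z j|
            ≤ 2 * (L * ‖δ‖ * M / m)} := (measure_mono hsub).trans (measure_biUnion_finset_le _ _)
      _ ≤ ∑ p ∈ T, ENNReal.ofReal (c / m) ^ n := by
          refine Finset.sum_le_sum fun p hp => ?_
          rw [← hcm]
          exact pi_dotProduct_close_le γ (k p) hs (hvar p (hTb p hp)) _ n
      _ = ENNReal.ofReal (T.card * (c / m) ^ n) := by
          rw [Finset.sum_const, nsmul_eq_mul, ENNReal.ofReal_mul (Nat.cast_nonneg _),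
            ENNReal.ofReal_natCast, ENNReal.ofReal_pow (by positivity)]
      _ ≤ ENNReal.ofReal (2 ^ d * c ^ n / m) := by
          refine ENNReal.ofReal_le_ofReal ?_
          have h1 : (T.card : ℝ) ≤ 2 ^ d * m ^ d := by
            have h2 : (T.card : ℝ) ≤ ((m : ℝ) + 1) ^ d := by exact_mod_cast hTc
            refine h2.trans ?_
            rw [← mul_pow]
            have : (1 : ℝ) ≤ m := by exact_mod_cast hm
            exact pow_le_pow_left₀ (by positivity) (by linarith) d
          have h3 : (m : ℝ) ^ (d + 1) ≤ m ^ n :=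
            pow_le_pow_right₀ (by exact_mod_cast hm) (by omega)
          calc T.card * (c / m) ^ n ≤ 2 ^ d * m ^ d * (c / m) ^ n :=
                mul_le_mul_of_nonneg_right h1 (by positivity)
            _ = 2 ^ d * c ^ n * (m ^ d / m ^ n) := by rw [div_pow]; ring
            _ ≤ 2 ^ d * c ^ n * (1 / m) := by
                refine mul_le_mul_of_nonneg_left ?_ (by positivity)
                rw [div_le_div_iff₀ (by positivity) hm', one_mul, ← pow_succ]
                exact h3
            _ = _ := by ring
  have hlim : Tendsto (fun m : ℕ => ENNReal.ofReal (2 ^ d * c ^ n / m)) atTop (𝓝 0) := by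
    have := ENNReal.tendsto_ofReal (tendsto_const_div_atTop_nhds_zero_nat (2 ^ d * c ^ n))
    simpa using this
  refine le_antisymm (ge_of_tendsto hlim ?_) bot_le
  filter_upwards [eventually_gt_atTop 0] with m hm using hbound m hm

end NoZeros

end SuRF

namespace SuRF

open Matrix

/-! ### Riemann sums of the estimated volume density -/

section Density

variable {ι V : Type*} [Fintype ι] [DecidableEq ι] [Fintype V]

/-- The volume density of the normalized Schur complement. -/
noncomputable def normVol (S : Matrix (Option ι) (Option ι) ℝ) : ℝ := √(normSchur S).det

/-- The sample covariance matrix of the linear forms `A a` of the data `z_1, …, z_N`. -/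
noncomputable def sampleJet {N : ℕ} (z : Fin N → V → ℝ) (A : Option ι → V → ℝ) :
    Matrix (Option ι) (Option ι) ℝ :=
  sampleCovMatrix fun i a => A a ⬝ᵥ z i

/-- The covariance matrix of the linear forms `A a` under `γ`. -/
noncomputable def popJet (γ : Measure (V → ℝ)) (A : Option ι → V → ℝ) :
    Matrix (Option ι) (Option ι) ℝ :=
  of fun a b => A a ⬝ᵥ (covMatrix γ *ᵥ A b)

omit [Fintype ι] [DecidableEq ι] in
theorem continuous_sampleJet {N : ℕ} :
    Continuous fun p : (Fin N → V → ℝ) × (Option ι → V → ℝ) => sampleJet p.1 p.2 := by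
  refine sampleCovMatrix_continuous.comp (continuous_pi fun i => continuous_pi fun a => ?_)
  exact Continuous.dotProduct (by fun_prop) (by fun_prop)

omit [Fintype ι] [DecidableEq ι] in
theorem continuous_popJet (γ : Measure (V → ℝ)) :
    Continuous fun A : Option ι → V → ℝ => popJet γ A := by
  refine continuous_matrix fun a b => ?_
  exact Continuous.dotProduct (by fun_prop)
    (Continuous.matrix_mulVec continuous_const (by fun_prop))

theorem continuousOn_normVol :
    ContinuousOn (normVol : Matrix (Option ι) (Option ι) ℝ → ℝ) {S | S none none ≠ 0} := by
  have h : ContinuousOn (normSchur : Matrix (Option ι) (Option ι) ℝ → Matrix ι ι ℝ)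
      {S | S none none ≠ 0} := by
    have hent : ∀ a b, Continuous fun S : Matrix (Option ι) (Option ι) ℝ => S a b :=
      fun a b => continuous_id.matrix_elem a b
    refine continuousOn_pi.2 fun i => continuousOn_pi.2 fun j => ?_
    refine ContinuousOn.sub ?_ ?_
    · exact (hent _ _).continuousOn.div (hent _ _).continuousOn fun S hS => hS
    · exact ((hent _ _).mul (hent _ _)).continuousOn.div ((hent _ _).pow 2).continuousOn
        fun S hS => pow_ne_zero 2 hS
  exact Real.continuous_sqrt.comp_continuousOn
    ((continuous_id.matrix_det (A := fun M : Matrix ι ι ℝ => M)).comp_continuousOn h)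

theorem measurable_normVol_sampleJet {N : ℕ} :
    Measurable fun p : (Fin N → V → ℝ) × (Option ι → V → ℝ) => normVol (sampleJet p.1 p.2) := by
  have hent : ∀ a b, Measurable fun p : (Fin N → V → ℝ) × (Option ι → V → ℝ) =>
      sampleJet p.1 p.2 a b := fun a b => (continuous_sampleJet.matrix_elem a b).measurable
  unfold normVol
  refine Measurable.sqrt ?_
  simp only [det_apply]
  refine Finset.measurable_fun_sum _ fun σ _ => Measurable.const_smul ?_ _
  refine Finset.measurable_fun_prod _ fun i _ => ?_
  exact ((hent _ _).div (hent _ _)).sub (((hent _ _).mul (hent _ _)).div ((hent _ _).pow_const 2))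

theorem measurable_normVol_sampleJet_left {N : ℕ} (A : Option ι → V → ℝ) :
    Measurable fun z : Fin N → V → ℝ => normVol (sampleJet z A) := by
  have h : Measurable (Function.uncurry fun (z : Fin N → V → ℝ) (A : Option ι → V → ℝ) =>
      normVol (sampleJet z A)) := measurable_normVol_sampleJet
  exact h.of_uncurry_right

theorem aemeasurable_normVol_sampleJet {N : ℕ} {α : Type*} [MeasurableSpace α] {μ : Measure α}
    {f : α → Fin N → V → ℝ} {A : α → Option ι → V → ℝ} (hf : AEMeasurable f μ)
    (hA : AEMeasurable A μ) : AEMeasurable (fun x => normVol (sampleJet (f x) (A x))) μ := by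
  have hR := measurable_normVol_sampleJet (ι := ι) (V := V) (N := N)
  have h := hR.comp_aemeasurable (hf.prodMk hA)
  exact h

theorem normVol_nonneg (S : Matrix (Option ι) (Option ι) ℝ) : 0 ≤ normVol S :=
  Real.sqrt_nonneg _

omit [Fintype ι] [DecidableEq ι] in
theorem covMatrix_map (γ : Measure (V → ℝ)) [IsGaussian γ] (A : Option ι → V → ℝ) :
    covMatrix (γ.map fun x a => A a ⬝ᵥ x) = popJet γ A := by
  have hm : Measurable fun (x : V → ℝ) a => A a ⬝ᵥ x :=
    measurable_pi_iff.2 fun a => (continuous_dotProduct_right _).measurable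
  ext a b
  rw [covMatrix, of_apply, covariance_map_fun (measurable_pi_apply a).aestronglyMeasurable
    (measurable_pi_apply b).aestronglyMeasurable hm.aemeasurable,
    covariance_dotProduct]
  rfl

omit [Fintype ι] [DecidableEq ι] in
theorem isGaussian_map_dotProduct (γ : Measure (V → ℝ)) [IsGaussian γ] [Finite ι]
    (A : Option ι → V → ℝ) : IsGaussian (γ.map fun x a => A a ⬝ᵥ x) := by
  have : (fun (x : V → ℝ) a => A a ⬝ᵥ x)
      = LinearMap.toContinuousLinearMap (mulVecLin (of A)) := by
    ext x a
    rfl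
  have _ := Fintype.ofFinite ι
  rw [this]
  infer_instance

/-- The plug-in estimator of the volume density is unbiased at each point. -/
theorem lintegral_normVol_sampleJet (γ : Measure (V → ℝ)) [IsGaussian γ] (A : Option ι → V → ℝ)
    (hA : 0 < popJet γ A none none) {N : ℕ} (hN : Fintype.card ι + 2 ≤ N) :
    ∫⁻ z, ENNReal.ofReal (normVol (sampleJet z A)) ∂(Measure.pi fun _ : Fin N => γ)
      = ENNReal.ofReal (normVol (popJet γ A)) := by
  have hG := isGaussian_map_dotProduct γ A
  have hm : Measurable fun (x : V → ℝ) a => A a ⬝ᵥ x :=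
    measurable_pi_iff.2 fun a => (continuous_dotProduct_right _).measurable
  have hmp : MeasurePreserving (fun (x : V → ℝ) a => A a ⬝ᵥ x) γ
      (γ.map fun x a => A a ⬝ᵥ x) := ⟨hm, rfl⟩
  have hmpi := measurePreserving_pi (fun _ : Fin N => γ) (fun _ : Fin N => _) fun _ => hmp
  have h := lintegral_sqrt_det_div (γ.map fun x a => A a ⬝ᵥ x) none (N := N)
    (by rw [Fintype.card_option]; omega)
  have hmeas : Measurable fun z : Fin N → Option ι → ℝ => ENNReal.ofReal
      √((sampleCovMatrix z).det / sampleCovMatrix z none none ^ Fintype.card (Option ι)) := by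
    have h1 : Continuous fun z : Fin N → Option ι → ℝ => (sampleCovMatrix z).det :=
      sampleCovMatrix_continuous.matrix_det
    have h2 : Continuous fun z : Fin N → Option ι → ℝ => sampleCovMatrix z none none :=
      sampleCovMatrix_continuous.matrix_elem _ _
    exact (h1.measurable.div (h2.measurable.pow_const _)).sqrt.ennreal_ofReal
  rw [← hmpi.lintegral_comp hmeas, covMatrix_map, Fintype.card_option] at h
  have hpop : normVol (popJet γ A)
      = √((popJet γ A).det / popJet γ A none none ^ (Fintype.card ι + 1)) := by
    rw [normVol, det_normSchur _ hA.ne']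
  rw [hpop, ← h]
  refine lintegral_congr_ae ?_
  have hvar : 0 < Var[fun x => A none ⬝ᵥ x; γ] := by
    rw [variance_dotProduct]; exact hA
  obtain ⟨n, rfl⟩ : ∃ n, N = n + 1 := ⟨N - 1, by omega⟩
  -- The determinant formula for the estimator requires a nonzero sample variance. Tolerance `η = 0`
  -- shows that exact coincidence of all values at this point is a null event.
  have h0 := pi_dotProduct_close_le γ (A none) hvar le_rfl 0 n
  rw [mul_zero, mul_zero, ENNReal.ofReal_zero, zero_pow (by omega), nonpos_iff_eq_zero,
    measure_eq_zero_iff_ae_notMem] at h0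
  filter_upwards [h0] with z hz
  have hS : sampleJet z A none none ≠ 0 := fun h0 => hz fun i j => by
    have := sampleCov_self_eq_zero (by omega) h0 i j
    simp [this]
  simp only [normVol]
  rw [det_normSchur _ hS]
  rfl

theorem integrable_normVol_sampleJet (γ : Measure (V → ℝ)) [IsGaussian γ]
    (A : Option ι → V → ℝ) (hA : 0 < popJet γ A none none) {N : ℕ}
    (hN : Fintype.card ι + 2 ≤ N) :
    Integrable (fun z => normVol (sampleJet z A)) (Measure.pi fun _ : Fin N => γ) ∧
      ∫ z, normVol (sampleJet z A) ∂(Measure.pi fun _ : Fin N => γ) = normVol (popJet γ A) := by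
  have h := lintegral_normVol_sampleJet γ A hA hN
  have hm : Measurable fun z : Fin N → V → ℝ => normVol (sampleJet z A) :=
    measurable_normVol_sampleJet_left A
  have hnn : ∀ z : Fin N → V → ℝ, 0 ≤ normVol (sampleJet z A) := fun z => normVol_nonneg _
  refine ⟨⟨hm.aestronglyMeasurable, ?_⟩, ?_⟩
  · rw [hasFiniteIntegral_iff_ofReal (Eventually.of_forall hnn), h]
    exact ENNReal.ofReal_lt_top
  · rw [integral_eq_lintegral_of_nonneg_ae (Eventually.of_forall hnn) hm.aestronglyMeasurable, h,
      ENNReal.toReal_ofReal (normVol_nonneg _)]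

/-- Expectation commutes with the finite grid sums, so pointwise unbiasedness reduces the first
limit to a deterministic Riemann sum. The almost sure limit is the integral of the estimated density
over `F`. That density is nonnegative with integrable mean, hence jointly integrable, and Fubini
gives the expectation of the limit. -/
theorem limitsUnbiased_of_isBoxUnion {δ : ι → ℝ} {E : Finset (ι → ℝ)} {F : Set (ι → ℝ)}
    (h : IsBoxUnion δ E F) (γ : Measure (V → ℝ)) [IsGaussian γ] (J : (ι → ℝ) → Option ι → V → ℝ)
    (hJ : ContinuousOn J (⋃ b ∈ E, closedBox δ b))
    (hlip : ∀ b ∈ E, ∃ L, 0 ≤ L ∧ ∀ y ∈ closedBox δ b, ∀ y' ∈ closedBox δ b, ∀ v,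
      |J y none v - J y' none v| ≤ L * ‖y - y'‖)
    (hpos : ∀ b ∈ E, ∀ y ∈ closedBox δ b, 0 < popJet γ (J y) none none)
    {N : ℕ} (hN : Fintype.card ι + 2 ≤ N) :
    LimitsUnbiased (Measure.pi fun _ : Fin N => γ)
      (fun r z => ∑ᶠ y ∈ F ∩ ⋃ b ∈ E, closedBox δ b ∩ boxGrid δ b (r + 1),
        normVol (sampleJet z (J y)) * ∏ i, δ i / ((r : ℝ) + 1))
      (∫ y in F, normVol (popJet γ (J y))) := by
  set π := Measure.pi fun _ : Fin N => γ with hπ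
  have hboxsub : ∀ b ∈ E, closedBox δ b ⊆ ⋃ b ∈ E, closedBox δ b := fun b hb =>
    Set.subset_biUnion_of_mem (u := fun b => closedBox δ b) hb
  have hposF : ∀ y ∈ F, 0 < popJet γ (J y) none none := fun y hy => by
    obtain ⟨b, hb, hyb⟩ := Set.mem_iUnion₂.1 (h.subset hy)
    exact hpos b hb y hyb
  have hpopc : ∀ b ∈ E, ContinuousOn (fun y => normVol (popJet γ (J y))) (closedBox δ b) :=
    fun b hb => continuousOn_normVol.comp
      ((continuous_popJet γ).comp_continuousOn (hJ.mono (hboxsub b hb)))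
      fun y hy => (hpos b hb y hy).ne'
  have hgrid : Tendsto (fun k : ℕ => 2 * k + 1 + 1) atTop atTop :=
    tendsto_atTop_mono (fun k => by simp only [id]; omega) tendsto_id
  have hcast : ∀ k : ℕ, (((2 * k + 1 : ℕ) : ℝ) + 1) = ((2 * k + 1 + 1 : ℕ) : ℝ) := fun k => by
    push_cast; ring
  have hest : ∀ k : ℕ, Integrable (fun z => ∑ᶠ y ∈ F ∩ ⋃ b ∈ E, closedBox δ b ∩
        boxGrid δ b (2 * k + 1 + 1), normVol (sampleJet z (J y))
          * ∏ i, δ i / (((2 * k + 1 : ℕ) : ℝ) + 1)) π ∧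
      ∫ z, ∑ᶠ y ∈ F ∩ ⋃ b ∈ E, closedBox δ b ∩
        boxGrid δ b (2 * k + 1 + 1), normVol (sampleJet z (J y))
          * ∏ i, δ i / (((2 * k + 1 : ℕ) : ℝ) + 1) ∂π
        = ∑ᶠ y ∈ F ∩ ⋃ b ∈ E, closedBox δ b ∩ boxGrid δ b (2 * k + 1 + 1),
          normVol (popJet γ (J y)) * ∏ i, δ i / ((2 * k + 1 + 1 : ℕ) : ℝ) := by
    intro k
    have hfin := h.finite_inter_grid (n := 2 * k + 1 + 1) (by omega)
    simp only [finsum_mem_eq_finite_toFinset_sum _ hfin]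
    have hI : ∀ y ∈ hfin.toFinset, Integrable (fun z => normVol (sampleJet z (J y))
        * ∏ i, δ i / (((2 * k + 1 : ℕ) : ℝ) + 1)) π := fun y hy =>
      (integrable_normVol_sampleJet γ (J y)
        (hposF y ((Set.Finite.mem_toFinset _).1 hy).1) hN).1.mul_const _
    refine ⟨integrable_finsetSum _ hI, ?_⟩
    rw [integral_finsetSum _ hI]
    refine Finset.sum_congr rfl fun y hy => ?_
    rw [integral_mul_const, (integrable_normVol_sampleJet γ (J y)
        (hposF y ((Set.Finite.mem_toFinset _).1 hy).1) hN).2, hcast]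
  have hIpop : IntegrableOn (fun y => normVol (popJet γ (J y))) F := by
    refine IntegrableOn.mono_set ?_ h.subset
    rw [integrableOn_finset_iUnion]
    exact fun b hb => (hpopc b hb).integrableOn_compact (isCompact_closedBox δ b)
  -- joint integrability
  have hJm : AEMeasurable J (volume.restrict F) := by
    refine AEMeasurable.mono_measure ?_ (Measure.restrict_mono h.subset le_rfl)
    refine hJ.aemeasurable ?_
    exact Finset.measurableSet_biUnion _ fun b _ => (isClosed_closedBox δ b).measurableSet
  have hjm : AEMeasurable (fun p : (Fin N → V → ℝ) × (ι → ℝ) => normVol (sampleJet p.1 (J p.2)))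
      (π.prod (volume.restrict F)) := by
    exact aemeasurable_normVol_sampleJet measurable_fst.aemeasurable hJm.comp_snd
  have hjoint : Integrable (fun p : (Fin N → V → ℝ) × (ι → ℝ) => normVol (sampleJet p.1 (J p.2)))
      (π.prod (volume.restrict F)) := by
    refine ⟨hjm.aestronglyMeasurable, ?_⟩
    rw [hasFiniteIntegral_iff_ofReal (Eventually.of_forall fun p => normVol_nonneg _),
      lintegral_prod_symm _ hjm.ennreal_ofReal]
    have : ∫⁻ y in F, ∫⁻ z, ENNReal.ofReal (normVol (sampleJet z (J y))) ∂π
        = ∫⁻ y in F, ENNReal.ofReal (normVol (popJet γ (J y))) :=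
      setLIntegral_congr_fun h.measurableSet fun y hy =>
        lintegral_normVol_sampleJet γ (J y) (hposF y hy) hN
    rw [this, ← ofReal_integral_eq_lintegral_ofReal hIpop
      (Eventually.of_forall fun p => normVol_nonneg _)]
    exact ENNReal.ofReal_lt_top
  refine ⟨fun k => (hest k).1, ?_, fun z => ∫ y in F, normVol (sampleJet z (J y)), ?_, ?_, ?_⟩
  · simp_rw [fun k => (hest k).2]
    exact (h.tendsto_riemannSum (fun y => normVol_nonneg _) hpopc).comp hgrid
  · have hnz : ∀ᵐ z ∂π, ∀ b ∈ E, ∀ y ∈ closedBox δ b, 0 < sampleJet z (J y) none none := by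
      rw [Filter.eventually_all_finset]
      intro b hb
      obtain ⟨L, hL0, hL⟩ := hlip b hb
      rcases (closedBox δ b).eq_empty_or_nonempty with hemp | hne
      · exact Eventually.of_forall fun z y hy => by simp [hemp] at hy
      have hvc : ContinuousOn (fun y => popJet γ (J y) none none) (closedBox δ b) :=
        ((continuous_popJet γ).matrix_elem none none).comp_continuousOn (hJ.mono (hboxsub b hb))
      -- The minimum of the population variance over the compact box is the uniform lower bound `s`
      -- in `ae_sampleCov_pos`.
      obtain ⟨y0, hy0, hmin⟩ := (isCompact_closedBox δ b).exists_isMinOn hne hvc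
      refine ae_sampleCov_pos h.side_pos b γ (fun y => J y none) hL0 hL (hpos b hb y0 hy0)
        (fun y hy => ?_) hN
      rw [variance_dotProduct]
      exact hmin hy
    filter_upwards [hnz] with z hz
    have hc : ∀ b ∈ E, ContinuousOn (fun y => normVol (sampleJet z (J y))) (closedBox δ b) :=
      fun b hb => continuousOn_normVol.comp
        ((continuous_sampleJet.comp (Continuous.prodMk_right z)).comp_continuousOn
          (hJ.mono (hboxsub b hb)))
        fun y hy => (hz b hb y hy).ne'
    have := (h.tendsto_riemannSum (fun y => normVol_nonneg (sampleJet z (J y))) hc).comp hgrid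
    refine this.congr fun k => ?_
    simp only [Function.comp, hcast]
  · exact hjoint.integral_prod_left
  · rw [integral_integral_swap hjoint]
    exact setIntegral_congr_fun h.measurableSet fun y hy =>
      (integrable_normVol_sampleJet γ (J y) (hposF y hy) hN).2

end Density

/-! ### Operations on `LimitsUnbiased` -/

theorem LimitsUnbiased.sum {Ω α : Type*} [MeasurableSpace Ω] {P : Measure Ω} {s : Finset α}
    {est : α → ℕ → Ω → ℝ} {L : α → ℝ} (h : ∀ a ∈ s, LimitsUnbiased P (est a) (L a)) :
    LimitsUnbiased P (fun r ω => ∑ a ∈ s, est a r ω) (∑ a ∈ s, L a) := by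
  classical
  have h3 := fun a ha => (h a ha).2.2
  choose! e he using h3
  refine ⟨fun k => integrable_finsetSum _ fun a ha => (h a ha).1 k, ?_,
    fun ω => ∑ a ∈ s, e a ω, ?_, ?_, ?_⟩
  · have : ∀ k : ℕ, ∫ ω, ∑ a ∈ s, est a (2 * k + 1) ω ∂P
        = ∑ a ∈ s, ∫ ω, est a (2 * k + 1) ω ∂P := fun k =>
      integral_finsetSum _ fun a ha => (h a ha).1 k
    simp_rw [this]
    exact tendsto_finsetSum _ fun a ha => (h a ha).2.1
  · have : ∀ᵐ ω ∂P, ∀ a ∈ s, Tendsto (fun k : ℕ => est a (2 * k + 1) ω) atTop (𝓝 (e a ω)) := by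
      rw [Filter.eventually_all_finset]
      exact fun a ha => (he a ha).1
    filter_upwards [this] with ω hω
    exact tendsto_finsetSum _ fun a ha => hω a ha
  · exact integrable_finsetSum _ fun a ha => (he a ha).2.1
  · rw [integral_finsetSum _ fun a ha => (he a ha).2.1]
    exact Finset.sum_congr rfl fun a ha => (he a ha).2.2

theorem LimitsUnbiased.comp {Ω Ω' : Type*} [MeasurableSpace Ω] [MeasurableSpace Ω']
    {P : Measure Ω} {Z : Ω → Ω'} (hZ : AEMeasurable Z P) {est : ℕ → Ω' → ℝ} {L : ℝ}
    (h : LimitsUnbiased (P.map Z) est L) : LimitsUnbiased P (fun r ω => est r (Z ω)) L := by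
  obtain ⟨h1, h2, e, h3, h4, h5⟩ := h
  refine ⟨fun k => (h1 k).comp_aemeasurable hZ, ?_, fun ω => e (Z ω), ae_of_ae_map hZ h3,
    h4.comp_aemeasurable hZ, ?_⟩
  · refine h2.congr fun k => ?_
    rw [integral_map hZ (h1 k).aestronglyMeasurable]
  · rw [← h5, integral_map hZ h4.aestronglyMeasurable]

end SuRF

namespace SuRF

/-! ### The geometry of voxel manifolds -/

section Voxels

variable {D : ℕ} {𝒱 : Finset (Fin D → ℝ)}

theorem spacing_le {v w : Fin D → ℝ} (hv : v ∈ 𝒱) (hw : w ∈ 𝒱) {d : Fin D} (h : v d ≠ w d) :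
    spacing 𝒱 d ≤ |v d - w d| := by
  refine csInf_le ⟨0, ?_⟩ ⟨v, hv, w, hw, h, rfl⟩
  rintro t ⟨v, -, w, -, -, rfl⟩
  exact abs_nonneg _

theorem spacing_pos {d : Fin D} (h : ∃ v ∈ 𝒱, ∃ w ∈ 𝒱, v d ≠ w d) : 0 < spacing 𝒱 d := by
  set S := {t : ℝ | ∃ v ∈ 𝒱, ∃ w ∈ 𝒱, v d ≠ w d ∧ t = |v d - w d|} with hS
  have hne : S.Nonempty := by
    obtain ⟨v, hv, w, hw, hvw⟩ := h
    exact ⟨_, v, hv, w, hw, hvw, rfl⟩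
  have hfin : S.Finite := by
    refine ((𝒱 ×ˢ 𝒱).finite_toSet.image fun p => |p.1 d - p.2 d|).subset ?_
    rintro t ⟨v, hv, w, hw, -, rfl⟩
    exact ⟨(v, w), by simp [hv, hw], rfl⟩
  obtain ⟨v, -, w, -, hvw, ht⟩ := hne.csInf_mem hfin
  have : spacing 𝒱 d = |v d - w d| := ht
  rw [this]
  exact abs_pos.2 (sub_ne_zero.2 hvw)

theorem voxel_eq_closedBox (v : Fin D → ℝ) : voxel 𝒱 v = closedBox (spacing 𝒱) v := rfl

theorem interior_closedBox {ι : Type*} [Finite ι] (δ b : ι → ℝ) :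
    interior (closedBox δ b) = openBox δ b := by
  rw [closedBox_eq_Icc, openBox_eq_pi, ← Set.pi_univ_Icc, interior_pi_set Set.finite_univ]
  simp

theorem exists_separating_coord {v w : Fin D → ℝ} (hv : v ∈ 𝒱) (hw : w ∈ 𝒱) (h : v ≠ w) :
    ∃ d, spacing 𝒱 d ≤ |v d - w d| := by
  obtain ⟨d, hd⟩ := Function.ne_iff.1 h
  exact ⟨d, spacing_le hv hw hd⟩

/-- Two voxels containing points that are close in direction `d` share their `d`-th coordinate. -/
theorem coord_eq_of_abs_lt {v w : Fin D → ℝ} (hv : v ∈ 𝒱) (hw : w ∈ 𝒱) {d : Fin D} {t : ℝ}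
    (h1 : |t - v d| < spacing 𝒱 d / 2) (h2 : |t - w d| ≤ spacing 𝒱 d / 2) : w d = v d := by
  by_contra h
  have h3 := spacing_le hw hv h
  have h4 := abs_lt.1 h1
  have h5 := abs_le.1 h2
  rcases le_abs.1 h3 with h6 | h6 <;> linarith

theorem measurableSet_voxelManifold : MeasurableSet (voxelManifold 𝒱) :=
  Finset.measurableSet_biUnion _ fun v _ => (isClosed_closedBox (spacing 𝒱) v).measurableSet

theorem isBoxUnion_voxelManifold (hδ : ∀ d, 0 < spacing 𝒱 d) :
    IsBoxUnion (spacing 𝒱) 𝒱 (voxelManifold 𝒱) where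
  side_pos := hδ
  separated _ hv _ hw h := exists_separating_coord hv hw h
  measurableSet := measurableSet_voxelManifold
  subset := subset_rfl
  openBox_subset_or_disjoint _ hv := Or.inl ((openBox_subset_closedBox _ _).trans
    (Set.subset_biUnion_of_mem (u := fun v => closedBox (spacing 𝒱) v) hv))

theorem grid_eq (r : ℕ) :
    grid 𝒱 r = voxelManifold 𝒱 ∩
      ⋃ v ∈ 𝒱, closedBox (spacing 𝒱) v ∩ boxGrid (spacing 𝒱) v (r + 1) := by
  rw [Set.inter_eq_right.2]
  · simp only [grid, boxGrid, Nat.cast_add, Nat.cast_one]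
    rfl
  · exact Set.iUnion₂_mono fun v _ => Set.inter_subset_left

/-- The points of the grid in a voxel belong to the grid through its centre. -/
theorem exists_int_of_mem_voxels {v w : Fin D → ℝ} (hv : v ∈ 𝒱) (hw : w ∈ 𝒱) {d : Fin D} {t : ℝ}
    (h1 : |t - v d| ≤ spacing 𝒱 d / 2) (h2 : |t - w d| ≤ spacing 𝒱 d / 2) {r : ℕ}
    (h : ∃ z : ℤ, t = w d + spacing 𝒱 d / ((r : ℝ) + 1) * z) :
    ∃ z : ℤ, t = v d + spacing 𝒱 d / ((r : ℝ) + 1) * z := by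
  obtain ⟨z, hz⟩ := h
  by_cases hvw : w d = v d
  · exact ⟨z, by rw [← hvw, hz]⟩
  have h3 := spacing_le hw hv hvw
  have h4 := abs_le.1 h1
  have h5 := abs_le.1 h2
  have hr : (r : ℝ) + 1 ≠ 0 := by positivity
  -- A coordinate `t` within half a spacing of two distinct centre coordinates forces these to
  -- differ by exactly one spacing, which is `r + 1` grid steps.
  rcases le_abs.1 h3 with h6 | h6
  · have : w d = v d + spacing 𝒱 d := by linarith
    refine ⟨z + (r + 1), ?_⟩
    rw [hz, this]
    push_cast
    field_simp
    ring
  · have : w d = v d - spacing 𝒱 d := by linarith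
    refine ⟨z - (r + 1), ?_⟩
    rw [hz, this]
    push_cast
    field_simp
    ring

/-! ### Faces -/

theorem glue_self (j : Fin D) (c : ℝ) (y : {i : Fin D // i ≠ j} → ℝ) : glue j c y j = c := by
  simp [glue]

theorem glue_of_ne {j i : Fin D} (h : i ≠ j) (c : ℝ) (y : {i : Fin D // i ≠ j} → ℝ) :
    glue j c y i = y ⟨i, h⟩ := by
  simp [glue, h]

theorem glue_restrict (j : Fin D) (x : Fin D → ℝ) : glue j (x j) (fun i => x i) = x := by
  ext i
  by_cases h : i = j
  · subst h; simp [glue]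
  · simp [glue, h]

theorem glue_injective (j : Fin D) (c : ℝ) : Function.Injective (glue j c) := by
  intro y y' h
  ext ⟨i, hi⟩
  have := congrFun h i
  rwa [glue_of_ne hi, glue_of_ne hi] at this

theorem contDiff_glue (j : Fin D) (c : ℝ) {n : WithTop ℕ∞} : ContDiff ℝ n (glue j c) := by
  refine contDiff_pi.2 fun i => ?_
  by_cases h : i = j
  · subst h
    simp only [glue_self]
    exact contDiff_const
  · simp only [glue_of_ne h]
    exact contDiff_apply ℝ ℝ _

/-- The centres, in the coordinates other than `j`, of the faces in the hyperplane `x_j = c`. -/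
noncomputable def faceCentres (𝒱 : Finset (Fin D → ℝ)) (j : Fin D) (c : ℝ) :
    Finset ({i : Fin D // i ≠ j} → ℝ) :=
  open Classical in (𝒱.filter fun v => |c - v j| = spacing 𝒱 j / 2).image fun v i => v i

theorem mem_faceCentres {j : Fin D} {c : ℝ} {b : {i : Fin D // i ≠ j} → ℝ} :
    b ∈ faceCentres 𝒱 j c ↔
      ∃ v ∈ 𝒱, |c - v j| = spacing 𝒱 j / 2 ∧ (fun i : {i : Fin D // i ≠ j} => v i) = b := by
  classical
  simp [faceCentres, and_assoc]

/-- The side lengths of the faces orthogonal to `e_j`. -/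
noncomputable abbrev faceSides (𝒱 : Finset (Fin D → ℝ)) (j : Fin D) :
    {i : Fin D // i ≠ j} → ℝ :=
  fun i => spacing 𝒱 i

theorem glue_mem_voxel {j : Fin D} {c : ℝ} {v : Fin D → ℝ} (hc : |c - v j| = spacing 𝒱 j / 2)
    {y : {i : Fin D // i ≠ j} → ℝ} :
    glue j c y ∈ voxel 𝒱 v ↔
      y ∈ closedBox (faceSides 𝒱 j) (fun i : {i : Fin D // i ≠ j} => v i) := by
  constructor
  · rintro h ⟨i, hi⟩
    have := h i
    rwa [glue_of_ne hi] at this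
  · intro h i
    by_cases hi : i = j
    · subst hi
      rw [glue_self, hc]
    · rw [glue_of_ne hi]
      exact h ⟨i, hi⟩

theorem mem_heights_of_mem_faces {T : Set (Fin D → ℝ)} {j : Fin D} {x : Fin D → ℝ}
    (hx : x ∈ faces 𝒱 T j) : x j ∈ heights 𝒱 j := by
  obtain ⟨-, v, hv, -, h⟩ := hx
  rw [heights, Finset.mem_union, Finset.mem_image, Finset.mem_image]
  have h0 : 0 ≤ spacing 𝒱 j / 2 := by rw [← h]; exact abs_nonneg _
  rcases (abs_eq h0).1 h with h | h
  · exact Or.inr ⟨v, hv, by linarith⟩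
  · exact Or.inl ⟨v, hv, by linarith⟩

theorem isOpen_of_stratum {T : Set (Fin D → ℝ)}
    (hT : T = openVoxels 𝒱 ∨ T = interior (voxelManifold 𝒱)) : IsOpen T := by
  rcases hT with rfl | rfl
  · exact isOpen_biUnion fun v _ => isOpen_interior
  · exact isOpen_interior

theorem measurableSet_faces {T : Set (Fin D → ℝ)} (hT : IsOpen T) (j : Fin D) :
    MeasurableSet (faces 𝒱 T j) := by
  have h : faces 𝒱 T j = (voxelManifold 𝒱 \ T) ∩
      ⋃ v ∈ 𝒱, voxel 𝒱 v ∩ {x | |x j - v j| = spacing 𝒱 j / 2} := by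
    ext x
    simp only [faces, Set.mem_ofPred_eq, Set.mem_inter_iff, Set.mem_iUnion₂, exists_prop]
  rw [h]
  refine (measurableSet_voxelManifold.diff hT.measurableSet).inter
    (Finset.measurableSet_biUnion _ fun v _ => ?_)
  exact (isClosed_closedBox _ _).measurableSet.inter
    (isClosed_eq (by fun_prop) continuous_const).measurableSet

/-- An open voxel containing the point would have a centre with the same `j`-th coordinate as `v`,
yet the point is at distance exactly `spacing 𝒱 j / 2` from `v` in that direction. -/
theorem glue_notMem_openVoxels {j : Fin D} {c : ℝ} {v : Fin D → ℝ} (hv : v ∈ 𝒱)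
    (hc : |c - v j| = spacing 𝒱 j / 2) {y : {i : Fin D // i ≠ j} → ℝ}
    (hy : glue j c y ∈ voxel 𝒱 v) : glue j c y ∉ openVoxels 𝒱 := by
  intro h
  obtain ⟨w, hw, hyw⟩ := Set.mem_iUnion₂.1 h
  rw [voxel_eq_closedBox, interior_closedBox] at hyw
  have h1 := coord_eq_of_abs_lt hw hv (hyw j) (hy j)
  have h2 := hyw j
  rw [← h1, glue_self, hc] at h2
  exact lt_irrefl _ h2

/-- An open face is part of the boundary of the voxel manifold unless it is shared by two
voxels, in which case it is contained in the interior. -/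
theorem openFace_interior_dichotomy {j : Fin D} {c : ℝ} {v : Fin D → ℝ}
    (hv : v ∈ 𝒱) (hc : |c - v j| = spacing 𝒱 j / 2) :
    (∀ y ∈ openBox (faceSides 𝒱 j) (fun i : {i : Fin D // i ≠ j} => v i),
        glue j c y ∉ interior (voxelManifold 𝒱)) ∨
      ∀ y ∈ openBox (faceSides 𝒱 j) (fun i : {i : Fin D // i ≠ j} => v i),
        glue j c y ∈ interior (voxelManifold 𝒱) := by
  -- The deciding question is whether a voxel `w` adjoins `v` across this face. If so, the two
  -- voxels together cover the open slab `|x j - c| < spacing 𝒱 j` over the open face.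
  by_cases h : ∃ w ∈ 𝒱, w ≠ v ∧ (∀ i, i ≠ j → w i = v i) ∧ |c - w j| = spacing 𝒱 j / 2
  · right
    obtain ⟨w, hw, hwv, hwi, hwc⟩ := h
    intro y hy
    have hδ0 : 0 ≤ spacing 𝒱 j / 2 := by rw [← hc]; exact abs_nonneg _
    have hne : w j ≠ v j := fun h => hwv <| by
      ext i
      by_cases hi : i = j
      · rw [hi, h]
      · exact hwi i hi
    have hopen : IsOpen ({x | |x j - c| < spacing 𝒱 j} ∩
        {x : Fin D → ℝ | (fun i : {i : Fin D // i ≠ j} => x i) ∈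
          openBox (faceSides 𝒱 j) (fun i : {i : Fin D // i ≠ j} => v i)}) :=
      (isOpen_lt (by fun_prop) continuous_const).inter
        ((isOpen_openBox _ _).preimage (by fun_prop))
    refine mem_interior.2 ⟨_, ?_, hopen, ?_, ?_⟩
    · rintro x ⟨hx1, hx2⟩
      have key : ∀ u ∈ 𝒱, (∀ i, i ≠ j → u i = v i) → |x j - u j| ≤ spacing 𝒱 j / 2 →
          x ∈ voxelManifold 𝒱 := fun u hu hui huj => by
        refine Set.mem_biUnion hu fun i => ?_
        by_cases hi : i = j
        · rw [hi]; exact huj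
        · rw [hui i hi]; exact (hx2 ⟨i, hi⟩).le
      have hx1' := abs_lt.1 (show |x j - c| < spacing 𝒱 j from hx1)
      rcases (abs_eq hδ0).1 hc with h1 | h1 <;> rcases (abs_eq hδ0).1 hwc with h2 | h2
      · exact absurd (by linarith) hne
      · rcases le_total (x j) c with h3 | h3
        · exact key v hv (fun _ _ => rfl) (abs_le.2 ⟨by linarith, by linarith⟩)
        · exact key w hw hwi (abs_le.2 ⟨by linarith, by linarith⟩)
      · rcases le_total (x j) c with h3 | h3
        · exact key w hw hwi (abs_le.2 ⟨by linarith, by linarith⟩)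
        · exact key v hv (fun _ _ => rfl) (abs_le.2 ⟨by linarith, by linarith⟩)
      · exact absurd (by linarith) hne
    · have hpos : 0 < spacing 𝒱 j := by
        rcases hδ0.lt_or_eq with h0 | h0
        · linarith
        · rw [← h0, abs_eq_zero] at hc hwc
          exact absurd (by linarith) hne
      simpa [glue_self] using hpos
    · rintro ⟨i, hi⟩
      have := hy ⟨i, hi⟩
      rwa [← glue_of_ne hi c y] at this
  · left
    intro y hy hint
    refine h ?_
    set x := glue j c y with hx
    have hxj : x j = c := glue_self j c y
    have hnv : x ∉ interior (voxel 𝒱 v) := fun hx' => by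
      rw [voxel_eq_closedBox, interior_closedBox] at hx'
      have := hx' j
      rw [hxj, hc] at this
      exact lt_irrefl _ this
    -- A point interior to the manifold but not to the voxel of `v` is a limit of points in other
    -- voxels. Their finite union is closed, so some other voxel contains `x`, and it must be the
    -- neighbour across the face.
    have hmem : x ∈ closure (⋃ w ∈ 𝒱.filter (· ≠ v), voxel 𝒱 w) := by
      rw [mem_closure_iff]
      intro O hO hxO
      have h1 : x ∈ closure (voxel 𝒱 v)ᶜ := by rw [closure_compl]; exact hnv
      obtain ⟨p, ⟨hpO, hpI⟩, hpv⟩ := mem_closure_iff.1 h1 (O ∩ interior (voxelManifold 𝒱))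
        (hO.inter isOpen_interior) ⟨hxO, hint⟩
      obtain ⟨w, hw, hpw⟩ := Set.mem_iUnion₂.1 (interior_subset hpI)
      exact ⟨p, hpO, Set.mem_iUnion₂.2
        ⟨w, Finset.mem_filter.2 ⟨hw, fun h => hpv (h ▸ hpw)⟩, hpw⟩⟩
    have hclosed : IsClosed (⋃ w ∈ 𝒱.filter (· ≠ v), voxel 𝒱 w) :=
      isClosed_biUnion_finset fun w _ => isClosed_closedBox (spacing 𝒱) w
    rw [hclosed.closure_eq] at hmem
    obtain ⟨w, hw, hxw⟩ := Set.mem_iUnion₂.1 hmem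
    rw [Finset.mem_filter] at hw
    have hwi : ∀ i, i ≠ j → w i = v i := fun i hi => by
      refine coord_eq_of_abs_lt hv hw.1 (hy ⟨i, hi⟩) ?_
      have := hxw i
      rwa [hx, glue_of_ne hi] at this
    have hne : w j ≠ v j := fun h => hw.2 <| by
      ext i
      by_cases hi : i = j
      · rw [hi, h]
      · exact hwi i hi
    refine ⟨w, hw.1, hw.2, hwi, ?_⟩
    have h1 := hxw j
    rw [hxj] at h1
    refine le_antisymm h1 ?_
    have h2 := spacing_le hw.1 hv hne
    have h3 : |w j - v j| ≤ |c - w j| + |c - v j| := by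
      have : w j - v j = -(c - w j) + (c - v j) := by ring
      rw [this]
      exact (abs_add_le _ _).trans (by rw [abs_neg])
    linarith

theorem isBoxUnion_faces (hδ : ∀ d, 0 < spacing 𝒱 d) {T : Set (Fin D → ℝ)}
    (hT : T = openVoxels 𝒱 ∨ T = interior (voxelManifold 𝒱)) (j : Fin D) (c : ℝ) :
    IsBoxUnion (faceSides 𝒱 j) (faceCentres 𝒱 j c)
      {y | glue j c y ∈ faces 𝒱 T j} where
  side_pos i := hδ i
  separated b hb b' hb' h := by
    obtain ⟨v, hv, -, rfl⟩ := mem_faceCentres.1 hb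
    obtain ⟨w, hw, -, rfl⟩ := mem_faceCentres.1 hb'
    obtain ⟨i, hi⟩ := Function.ne_iff.1 h
    exact ⟨i, spacing_le hv hw hi⟩
  measurableSet :=
    measurableSet_faces (isOpen_of_stratum hT) j |>.preimage
      (contDiff_glue (n := 0) j c).continuous.measurable
  subset := by
    rintro y ⟨-, v, hv, hy, hc⟩
    rw [glue_self] at hc
    exact Set.mem_biUnion (mem_faceCentres.2 ⟨v, hv, hc, rfl⟩) ((glue_mem_voxel hc).1 hy)
  openBox_subset_or_disjoint b hb := by
    obtain ⟨v, hv, hc, rfl⟩ := mem_faceCentres.1 hb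
    have hvox : ∀ y ∈ openBox (faceSides 𝒱 j) (fun i : {i : Fin D // i ≠ j} => v i),
        glue j c y ∈ voxel 𝒱 v := fun y hy =>
      (glue_mem_voxel hc).2 (openBox_subset_closedBox _ _ hy)
    have hface : ∀ y ∈ openBox (faceSides 𝒱 j) (fun i : {i : Fin D // i ≠ j} => v i),
        glue j c y ∉ T → glue j c y ∈ faces 𝒱 T j := fun y hy hyT =>
      ⟨⟨Set.mem_biUnion hv (hvox y hy), hyT⟩, v, hv, hvox y hy, by rw [glue_self, hc]⟩
    rcases hT with rfl | rfl
    · exact Or.inl fun y hy => hface y hy (glue_notMem_openVoxels hv hc (hvox y hy))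
    · rcases openFace_interior_dichotomy hv hc with h | h
      · exact Or.inl fun y hy => hface y hy (h y hy)
      · exact Or.inr (Set.disjoint_left.2 fun y hy hyF => hyF.1.2 (h y hy))

theorem glue_mem_voxelManifold {j : Fin D} {c : ℝ} {y : {i : Fin D // i ≠ j} → ℝ}
    (hy : y ∈ ⋃ b ∈ faceCentres 𝒱 j c, closedBox (faceSides 𝒱 j) b) :
    glue j c y ∈ voxelManifold 𝒱 := by
  obtain ⟨b, hb, hyb⟩ := Set.mem_iUnion₂.1 hy
  obtain ⟨v, hv, hc, rfl⟩ := mem_faceCentres.1 hb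
  exact Set.mem_biUnion hv ((glue_mem_voxel hc).2 hyb)

theorem glue_mem_faces_inter_grid_iff {T : Set (Fin D → ℝ)} {j : Fin D} {c : ℝ} (k : ℕ)
    (y : {i : Fin D // i ≠ j} → ℝ) :
    glue j c y ∈ faces 𝒱 T j ∩ grid 𝒱 (2 * k + 1) ↔
      y ∈ {y | glue j c y ∈ faces 𝒱 T j} ∩ ⋃ b ∈ faceCentres 𝒱 j c,
        closedBox (faceSides 𝒱 j) b ∩
          boxGrid (faceSides 𝒱 j) b (2 * k + 1 + 1) := by
  simp only [Set.mem_inter_iff, Set.mem_ofPred_eq]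
  refine and_congr_right fun hF => ?_
  constructor
  · intro hg
    obtain ⟨w, hw, hyw, z, hz⟩ := Set.mem_iUnion₂.1 hg
    obtain ⟨-, v, hv, hyv, hc⟩ := hF
    rw [glue_self] at hc
    refine Set.mem_biUnion (mem_faceCentres.2 ⟨v, hv, hc, rfl⟩)
      ⟨(glue_mem_voxel hc).1 hyv, ?_⟩
    have : ∀ i : {i : Fin D // i ≠ j}, ∃ z : ℤ,
        y i = v i + spacing 𝒱 i / (((2 * k + 1 : ℕ) : ℝ) + 1) * z := by
      rintro ⟨i, hi⟩
      rw [← glue_of_ne hi c y]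
      exact exists_int_of_mem_voxels hv hw (hyv i) (hyw i) ⟨z i, hz i⟩
    choose z' hz' using this
    refine ⟨z', fun i => ?_⟩
    rw [hz' i]
    push_cast
    rfl
  · intro hg
    obtain ⟨b, hb, hyb, z, hz⟩ := Set.mem_iUnion₂.1 hg
    obtain ⟨v, hv, hc, rfl⟩ := mem_faceCentres.1 hb
    refine Set.mem_biUnion hv ⟨(glue_mem_voxel hc).2 hyb, ?_⟩
    -- Here the added resolution has to be odd: half a spacing is `k + 1` steps of length `spacing 𝒱
    -- j / (2 * k + 2)`, so the grid through the centre meets the face.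
    have hj : ∃ m : ℤ, c = v j + spacing 𝒱 j / (((2 * k + 1 : ℕ) : ℝ) + 1) * (m : ℝ) := by
      have h0 : 0 ≤ spacing 𝒱 j / 2 := by rw [← hc]; exact abs_nonneg _
      have hk : (2 * (k : ℝ) + 1 + 1) ≠ 0 := by positivity
      rcases (abs_eq h0).1 hc with h | h
      · refine ⟨k + 1, ?_⟩
        push_cast
        have : c = v j + spacing 𝒱 j / 2 := by linarith
        rw [this]
        field_simp
        ring
      · refine ⟨-(k + 1), ?_⟩
        push_cast
        have : c = v j - spacing 𝒱 j / 2 := by linarith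
        rw [this]
        field_simp
        ring
    obtain ⟨m, hm⟩ := hj
    refine ⟨fun i => if hi : i = j then m else z ⟨i, hi⟩, fun i => ?_⟩
    by_cases hi : i = j
    · subst hi
      simp only [glue_self, dite_true]
      exact hm
    · rw [glue_of_ne hi, hz ⟨i, hi⟩]
      simp [hi]

/-- Sums over the grid points on faces, arranged according to the hyperplanes containing them. -/
theorem finsum_faces_inter_grid (hδ : ∀ d, 0 < spacing 𝒱 d) {T : Set (Fin D → ℝ)}
    (hT : T = openVoxels 𝒱 ∨ T = interior (voxelManifold 𝒱)) (j : Fin D) (k : ℕ)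
    (f : (Fin D → ℝ) → ℝ) :
    ∑ᶠ x ∈ faces 𝒱 T j ∩ grid 𝒱 (2 * k + 1), f x
      = ∑ c ∈ heights 𝒱 j, ∑ᶠ y ∈ {y | glue j c y ∈ faces 𝒱 T j} ∩ ⋃ b ∈ faceCentres 𝒱 j c,
        closedBox (faceSides 𝒱 j) b ∩
          boxGrid (faceSides 𝒱 j) b (2 * k + 1 + 1), f (glue j c y) := by
  set S : ℝ → Set ({i : Fin D // i ≠ j} → ℝ) := fun c =>
    {y | glue j c y ∈ faces 𝒱 T j} ∩ ⋃ b ∈ faceCentres 𝒱 j c,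
        closedBox (faceSides 𝒱 j) b ∩
          boxGrid (faceSides 𝒱 j) b (2 * k + 1 + 1) with hS
  have hSfin : ∀ c, (S c).Finite := fun c =>
    (isBoxUnion_faces hδ hT j c).finite_inter_grid (by omega)
  have hunion : faces 𝒱 T j ∩ grid 𝒱 (2 * k + 1)
      = ⋃ c ∈ (heights 𝒱 j : Set ℝ), glue j c '' S c := by
    ext x
    simp only [Set.mem_iUnion₂, exists_prop]
    constructor
    · intro hx
      refine ⟨x j, mem_heights_of_mem_faces hx.1, fun i => x i, ?_, glue_restrict j x⟩
      refine (glue_mem_faces_inter_grid_iff k _).1 ?_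
      rwa [glue_restrict]
    · rintro ⟨c, -, y, hy, rfl⟩
      exact (glue_mem_faces_inter_grid_iff k y).2 hy
  rw [hunion, finsum_mem_biUnion _ (heights 𝒱 j).finite_toSet
    fun c _ => (hSfin c).image (glue j c), finsum_mem_coe_finset]
  · exact Finset.sum_congr rfl fun c _ => finsum_mem_image (glue_injective j c).injOn
  · intro c _ c' _ hne
    refine Set.disjoint_left.2 ?_
    rintro x ⟨y, -, rfl⟩ ⟨y', -, h⟩
    have := congrFun h j
    rw [glue_self, glue_self] at this
    exact hne this.symm

end Voxels

end SuRF

namespace SuRF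

open Matrix

/-! ### Jets of the kernel, the metric and its estimator -/

section Jets

variable {D : ℕ} {𝒱 : Finset (Fin D → ℝ)} {ι : Type*}

theorem hasDerivAt_line {f : (Fin D → ℝ) → ℝ} {x : Fin D → ℝ} (hf : DifferentiableAt ℝ f x)
    (d : Fin D) : HasDerivAt (fun t : ℝ => f (x + t • Pi.single d 1)) (pderiv f d x) 0 := by
  have h1 : HasDerivAt (fun t : ℝ => x + t • (Pi.single d 1 : Fin D → ℝ)) (Pi.single d 1) 0 := by
    simpa using ((hasDerivAt_id (0 : ℝ)).smul_const (Pi.single d 1 : Fin D → ℝ)).const_add x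
  have h2 : HasFDerivAt f (fderiv ℝ f x) (x + (0 : ℝ) • Pi.single d 1) := by
    simpa using hf.hasFDerivAt
  exact h2.comp_hasDerivAt (0 : ℝ) h1

/-- The partial derivative of a field in direction `d`, as a linear form in the data. -/
noncomputable def kernelDeriv (K : (Fin D → ℝ) → 𝒱 → ℝ) (d : Fin D) (x : Fin D → ℝ) : 𝒱 → ℝ :=
  fun v => pderiv (fun s => K s v) d x

/-- The kernel and its partial derivatives in the directions `e i`. -/
noncomputable def jet (K : (Fin D → ℝ) → 𝒱 → ℝ) (e : ι → Fin D) (x : Fin D → ℝ) :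
    Option ι → 𝒱 → ℝ
  | none => K x
  | some i => kernelDeriv K (e i) x

theorem field_eq_dotProduct (K : (Fin D → ℝ) → 𝒱 → ℝ) (a : 𝒱 → ℝ) (x : Fin D → ℝ) :
    field K a x = K x ⬝ᵥ a := rfl

theorem differentiableAt_field {K : (Fin D → ℝ) → 𝒱 → ℝ} {x : Fin D → ℝ}
    (hK : ∀ v, DifferentiableAt ℝ (fun s => K s v) x) (a : 𝒱 → ℝ) :
    DifferentiableAt ℝ (field K a) x :=
  DifferentiableAt.fun_sum fun v _ => (hK v).mul_const (a v)

theorem pderiv_field {K : (Fin D → ℝ) → 𝒱 → ℝ} {x : Fin D → ℝ}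
    (hK : ∀ v, DifferentiableAt ℝ (fun s => K s v) x) (a : 𝒱 → ℝ) (d : Fin D) :
    pderiv (field K a) d x = kernelDeriv K d x ⬝ᵥ a := by
  refine (hasDerivAt_line (differentiableAt_field hK a) d).unique ?_
  exact HasDerivAt.fun_sum fun v _ => (hasDerivAt_line (hK v) d).mul_const (a v)

/-- The field and its derivatives are linear forms in the data, so all entries come from one sample
covariance matrix. Taking `e` to be `id` or `Subtype.val` covers the full metric and its minors
together. -/
theorem metricEst_submatrix {K : (Fin D → ℝ) → 𝒱 → ℝ} {x : Fin D → ℝ}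
    (hK : ∀ v, DifferentiableAt ℝ (fun s => K s v) x) (e : ι → Fin D) {N : ℕ}
    (Y : Fin N → 𝒱 → ℝ) :
    (metricEst K Y x).submatrix e e = normSchur (sampleJet Y (jet K e x)) := by
  ext i j
  simp only [metricEst, submatrix_apply, of_apply, normSchur, sampleJet, sampleCovMatrix, jet,
    pderiv_field hK, field_eq_dotProduct]

section Population

variable {Ω₀ : Type*} [MeasurableSpace Ω₀] {P₀ : Measure Ω₀} {X : Ω₀ → 𝒱 → ℝ}

theorem covMatrix_map_eq (hX : AEMeasurable X P₀) (u v : 𝒱) :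
    covMatrix (P₀.map X) u v = cov[fun ω => X ω u, fun ω => X ω v; P₀] := by
  rw [covMatrix, of_apply, covariance_map_fun (measurable_pi_apply u).aestronglyMeasurable
    (measurable_pi_apply v).aestronglyMeasurable hX]

theorem kernelNormSq_eq (K : (Fin D → ℝ) → 𝒱 → ℝ) (hX : AEMeasurable X P₀) (x : Fin D → ℝ) :
    kernelNormSq K X P₀ x = K x ⬝ᵥ (covMatrix (P₀.map X) *ᵥ K x) := by
  simp only [kernelNormSq, dotProduct, mulVec, covMatrix_map_eq hX, Finset.mul_sum]
  exact Finset.sum_congr rfl fun u _ => Finset.sum_congr rfl fun v _ => by ring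

theorem differentiableAt_kernelNormSq {K : (Fin D → ℝ) → 𝒱 → ℝ} {x : Fin D → ℝ}
    (hK : ∀ v, DifferentiableAt ℝ (fun s => K s v) x) :
    DifferentiableAt ℝ (kernelNormSq K X P₀) x :=
  DifferentiableAt.fun_sum fun u _ => DifferentiableAt.fun_sum fun v _ =>
    ((hK u).mul (hK v)).mul_const _

theorem pderiv_kernelNormSq {K : (Fin D → ℝ) → 𝒱 → ℝ} {x : Fin D → ℝ}
    (hK : ∀ v, DifferentiableAt ℝ (fun s => K s v) x) (hX : AEMeasurable X P₀) (d : Fin D) :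
    pderiv (kernelNormSq K X P₀) d x
      = 2 * (kernelDeriv K d x ⬝ᵥ (covMatrix (P₀.map X) *ᵥ K x)) := by
  refine (hasDerivAt_line (differentiableAt_kernelNormSq hK) d).unique ?_
  have h := HasDerivAt.fun_sum (u := Finset.univ) fun u _ => HasDerivAt.fun_sum
    (u := Finset.univ) fun v _ =>
    ((hasDerivAt_line (hK u) d).mul (hasDerivAt_line (hK v) d)).mul_const
      (cov[fun ω => X ω u, fun ω => X ω v; P₀])
  convert! h using 1
  simp only [zero_smul, add_zero, add_mul, Finset.sum_add_distrib, two_mul]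
  congr 1
  · simp only [dotProduct, mulVec, Finset.mul_sum, covMatrix_map_eq hX, kernelDeriv]
    exact Finset.sum_congr rfl fun u _ => Finset.sum_congr rfl fun v _ => by ring
  · rw [Finset.sum_comm]
    simp only [dotProduct, mulVec, Finset.mul_sum, covMatrix_map_eq hX, kernelDeriv]
    refine Finset.sum_congr rfl fun u _ => Finset.sum_congr rfl fun v _ => ?_
    rw [covariance_comm]
    ring

/-- The derivative of the normalized field, as a linear form in the data. -/
theorem pderiv_normalized_field {K : (Fin D → ℝ) → 𝒱 → ℝ} {x : Fin D → ℝ}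
    (hK : ∀ v, DifferentiableAt ℝ (fun s => K s v) x) (hX : AEMeasurable X P₀)
    (hpos : 0 < kernelNormSq K X P₀ x) (a : 𝒱 → ℝ) (d : Fin D) :
    pderiv (field (normalizedKernel K X P₀) a) d x
      = ((√(kernelNormSq K X P₀ x))⁻¹ • kernelDeriv K d x
        - ((kernelDeriv K d x ⬝ᵥ (covMatrix (P₀.map X) *ᵥ K x))
          / (kernelNormSq K X P₀ x * √(kernelNormSq K X P₀ x))) • K x) ⬝ᵥ a := by
  set q := kernelNormSq K X P₀ with hq
  have hfun : field (normalizedKernel K X P₀) a = fun s => field K a s / √(q s) := by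
    ext s
    simp only [field, normalizedKernel, Finset.sum_div, ← hq]
    exact Finset.sum_congr rfl fun v _ => by ring
  have hqd : DifferentiableAt ℝ q x := differentiableAt_kernelNormSq hK
  have hs : 0 < √(q x) := Real.sqrt_pos.2 hpos
  have hsd : DifferentiableAt ℝ (fun s => √(q s)) x := hqd.sqrt hpos.ne'
  have hd : DifferentiableAt ℝ (fun s => field K a s / √(q s)) x := by
    simp only [div_eq_mul_inv]
    exact (differentiableAt_field hK a).fun_mul (hsd.fun_inv hs.ne')
  rw [hfun]
  refine (hasDerivAt_line hd d).unique ?_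
  have h1 := hasDerivAt_line (differentiableAt_field hK a) d
  have h2 := hasDerivAt_line hqd d
  have h3 := h1.div (h2.sqrt (by simpa using hpos.ne')) (by simpa using hs.ne')
  convert! h3 using 1
  simp only [zero_smul, add_zero]
  rw [pderiv_field hK, hq, pderiv_kernelNormSq hK hX, ← hq, field_eq_dotProduct, sub_dotProduct,
    smul_dotProduct, smul_dotProduct, smul_eq_mul, smul_eq_mul]
  have h4 : q x = √(q x) ^ 2 := (Real.sq_sqrt hpos.le).symm
  generalize √(q x) = w at *
  rw [h4]
  field_simp

/-- By the quotient rule, the derivative of the normalized field is the derivative of the field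
minus its regression on the field value, divided by the standard deviation. The covariance of such
residuals is the Schur complement, here divided by the variance. -/
theorem metric_submatrix {K : (Fin D → ℝ) → 𝒱 → ℝ} {x : Fin D → ℝ}
    (hK : ∀ v, DifferentiableAt ℝ (fun s => K s v) x) [IsGaussian (P₀.map X)]
    (hX : AEMeasurable X P₀) (hpos : 0 < kernelNormSq K X P₀ x) (e : ι → Fin D) :
    (metric K X P₀ x).submatrix e e = normSchur (popJet (P₀.map X) (jet K e x)) := by
  ext i j
  simp only [metric, submatrix_apply, of_apply, pderiv_normalized_field hK hX hpos]
  have hcov : ∀ c d : 𝒱 → ℝ, cov[fun ω => c ⬝ᵥ X ω, fun ω => d ⬝ᵥ X ω; P₀]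
      = c ⬝ᵥ (covMatrix (P₀.map X) *ᵥ d) := fun c d => by
    rw [← covariance_dotProduct,
      covariance_map_fun (continuous_dotProduct_right c).aestronglyMeasurable
        (continuous_dotProduct_right d).aestronglyMeasurable hX]
  have hsymm : ∀ c d : 𝒱 → ℝ, c ⬝ᵥ (covMatrix (P₀.map X) *ᵥ d)
      = d ⬝ᵥ (covMatrix (P₀.map X) *ᵥ c) := fun c d => by
    rw [← covariance_dotProduct, covariance_comm, covariance_dotProduct]
  rw [hcov]
  simp only [normSchur, popJet, of_apply, jet, mulVec_sub, mulVec_smul, dotProduct_sub,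
    sub_dotProduct, smul_dotProduct, dotProduct_smul, smul_eq_mul]
  rw [hsymm (K x) (kernelDeriv K (e j) x), ← kernelNormSq_eq K hX]
  set q := kernelNormSq K X P₀ x
  have h4 : q = √q ^ 2 := (Real.sq_sqrt hpos.le).symm
  have hs : 0 < √q := Real.sqrt_pos.2 hpos
  generalize √q = w at *
  rw [h4]
  field_simp
  ring

end Population

theorem differentiableAt_of_contDiffOn {K : (Fin D → ℝ) → 𝒱 → ℝ} {U : Set (Fin D → ℝ)}
    (hU : IsOpen U) (hK : ∀ v : 𝒱, ContDiffOn ℝ 3 (fun s => K s v) U) {x : Fin D → ℝ} (hx : x ∈ U)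
    (v : 𝒱) : DifferentiableAt ℝ (fun s => K s v) x :=
  ((hK v).contDiffAt (hU.mem_nhds hx)).differentiableAt (by norm_num)

theorem continuousOn_jet {K : (Fin D → ℝ) → 𝒱 → ℝ} {U : Set (Fin D → ℝ)}
    (hU : IsOpen U) (hK : ∀ v : 𝒱, ContDiffOn ℝ 3 (fun s => K s v) U) (e : ι → Fin D) :
    ContinuousOn (jet K e) U := by
  refine continuousOn_pi.2 fun a => continuousOn_pi.2 fun v => ?_
  cases a with
  | none => exact (hK v).continuousOn
  | some i =>
    exact ((hK v).continuousOn_fderiv_of_isOpen hU (by norm_num)).clm_apply continuousOn_const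

theorem exists_lipschitz_box [Fintype ι] {V : Type*} [Fintype V] {δ b : ι → ℝ}
    {k : (ι → ℝ) → V → ℝ} (hk : ∀ v, ContDiffOn ℝ 1 (fun y => k y v) (closedBox δ b)) :
    ∃ L, 0 ≤ L ∧ ∀ y ∈ closedBox δ b, ∀ y' ∈ closedBox δ b, ∀ v,
      |k y v - k y' v| ≤ L * ‖y - y'‖ := by
  have hconv : Convex ℝ (closedBox δ b) := by
    rw [closedBox_eq_Icc]; exact convex_Icc _ _
  have hL : ∀ v, ∃ L, LipschitzOnWith L (fun y => k y v) (closedBox δ b) := fun v => by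
    refine LocallyLipschitzOn.exists_lipschitzOnWith_of_compact (isCompact_closedBox δ b) ?_
    exact fun x hx => (hk v x hx).exists_lipschitzOnWith hconv
  choose L hL using hL
  refine ⟨∑ v, (L v : ℝ), Finset.sum_nonneg fun v _ => (L v).2, fun y hy y' hy' v => ?_⟩
  have h1 := (hL v).dist_le_mul y hy y' hy'
  rw [Real.dist_eq, dist_eq_norm] at h1
  refine h1.trans (mul_le_mul_of_nonneg_right ?_ (norm_nonneg _))
  exact Finset.single_le_sum (f := fun v => (L v : ℝ)) (fun v _ => (L v).2) (Finset.mem_univ v)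

theorem LimitsUnbiased.congr {Ω : Type*} [MeasurableSpace Ω] {P : Measure Ω}
    {est est' : ℕ → Ω → ℝ} {L L' : ℝ} (h : LimitsUnbiased P est L)
    (he : ∀ k ω, est (2 * k + 1) ω = est' (2 * k + 1) ω) (hL : L = L') :
    LimitsUnbiased P est' L' := by
  have he' : ∀ k, est (2 * k + 1) = est' (2 * k + 1) := fun k => funext (he k)
  simp only [LimitsUnbiased, he', hL] at h ⊢
  exact h

/-- Unbiasedness of the estimated volume of a union of boxes in the image of a coordinate plane. -/
theorem limitsUnbiased_submatrix [Fintype ι] [DecidableEq ι]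
    {K : (Fin D → ℝ) → 𝒱 → ℝ} {U : Set (Fin D → ℝ)} (hU : IsOpen U)
    (hMU : voxelManifold 𝒱 ⊆ U) (hK : ∀ v : 𝒱, ContDiffOn ℝ 3 (fun s => K s v) U)
    {Ω₀ : Type*} [MeasurableSpace Ω₀] {P₀ : Measure Ω₀}
    {X : Ω₀ → 𝒱 → ℝ} (hX : HasGaussianLaw X P₀)
    (hpos : ∀ x ∈ voxelManifold 𝒱, 0 < kernelNormSq K X P₀ x)
    {δ : ι → ℝ} {E : Finset (ι → ℝ)} {F : Set (ι → ℝ)} (h : IsBoxUnion δ E F)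
    (e : ι → Fin D) {g : (ι → ℝ) → Fin D → ℝ} (hg : ContDiff ℝ 3 g)
    (hgM : ∀ y ∈ ⋃ b ∈ E, closedBox δ b, g y ∈ voxelManifold 𝒱)
    {N : ℕ} (hN : Fintype.card ι + 2 ≤ N) :
    LimitsUnbiased (Measure.pi fun _ : Fin N => P₀.map X)
      (fun r z => ∑ᶠ y ∈ F ∩ ⋃ b ∈ E, closedBox δ b ∩ boxGrid δ b (r + 1),
        √((metricEst K z (g y)).submatrix e e).det * ∏ i, δ i / ((r : ℝ) + 1))
      (∫ y in F, √((metric K X P₀ (g y)).submatrix e e).det) := by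
  have hG := hX.isGaussian_map
  have hXm := hX.aemeasurable
  have hdiff : ∀ y ∈ ⋃ b ∈ E, closedBox δ b, ∀ v, DifferentiableAt ℝ (fun s => K s v) (g y) :=
    fun y hy => differentiableAt_of_contDiffOn hU hK (hMU (hgM y hy))
  have hsub : ∀ b ∈ E, closedBox δ b ⊆ ⋃ b ∈ E, closedBox δ b := fun b hb =>
    Set.subset_biUnion_of_mem (u := fun b => closedBox δ b) hb
  refine (limitsUnbiased_of_isBoxUnion h (P₀.map X) (fun y => jet K e (g y)) ?_ ?_ ?_ hN).congr
    ?_ ?_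
  · exact (continuousOn_jet hU hK e).comp hg.continuous.continuousOn
      fun y hy => hMU (hgM y hy)
  · intro b hb
    refine exists_lipschitz_box (k := fun y => K (g y)) fun v => ?_
    exact (((hK v).comp hg.contDiffOn fun y hy => hMU (hgM y (hsub b hb hy))).of_le (by norm_num))
  · intro b hb y hy
    have := hpos _ (hgM y (hsub b hb hy))
    rwa [kernelNormSq_eq K hXm] at this
  · intro k z
    refine finsum_mem_congr rfl fun y hy => ?_
    rw [metricEst_submatrix (hdiff y (h.subset hy.1))]
    rfl
  · refine setIntegral_congr_fun h.measurableSet fun y hy => ?_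
    rw [metric_submatrix (hdiff y (h.subset hy)) hXm (hpos _ (hgM y (h.subset hy)))]
    rfl

end Jets

end SuRF

namespace SuRF

open Matrix

/-! ### Unbiasedness of the estimated curvatures -/

section Curvatures

variable {D : ℕ} {𝒱 : Finset (Fin D → ℝ)} {K : (Fin D → ℝ) → 𝒱 → ℝ} {U : Set (Fin D → ℝ)}
  {Ω₀ : Type*} [MeasurableSpace Ω₀] {P₀ : Measure Ω₀} {X : Ω₀ → 𝒱 → ℝ}

theorem continuousOn_vol_metric (hU : IsOpen U) (hMU : voxelManifold 𝒱 ⊆ U)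
    (hK : ∀ v : 𝒱, ContDiffOn ℝ 3 (fun s => K s v) U) (hX : HasGaussianLaw X P₀)
    (hpos : ∀ x ∈ voxelManifold 𝒱, 0 < kernelNormSq K X P₀ x) :
    ContinuousOn (fun x => vol (metric K X P₀ x)) (voxelManifold 𝒱) := by
  have hG := hX.isGaussian_map
  have hXm := hX.aemeasurable
  have hJ : ContinuousOn (fun x => popJet (P₀.map X) (jet K id x)) (voxelManifold 𝒱) :=
    (continuous_popJet (P₀.map X)).comp_continuousOn ((continuousOn_jet hU hK id).mono hMU)
  have hvol : ContinuousOn (fun x => normVol (popJet (P₀.map X) (jet K id x)))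
      (voxelManifold 𝒱) := by
    refine continuousOn_normVol.comp hJ fun x hx => ?_
    have := hpos x hx
    rw [kernelNormSq_eq K hXm] at this
    exact this.ne'
  refine hvol.congr fun x hx => ?_
  have h := metric_submatrix (differentiableAt_of_contDiffOn hU hK (hMU hx)) hXm (hpos x hx) id
  rw [submatrix_id_id] at h
  simp only [vol, normVol, h]

theorem lkcTop_metric_eq (hδ : ∀ d, 0 < spacing 𝒱 d) (hU : IsOpen U) (hMU : voxelManifold 𝒱 ⊆ U)
    (hK : ∀ v : 𝒱, ContDiffOn ℝ 3 (fun s => K s v) U) (hX : HasGaussianLaw X P₀)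
    (hpos : ∀ x ∈ voxelManifold 𝒱, 0 < kernelNormSq K X P₀ x) :
    lkcTop 𝒱 (metric K X P₀) = ∫ x in voxelManifold 𝒱, vol (metric K X P₀ x) := by
  have hinter : ∀ v ∈ 𝒱, voxelManifold 𝒱 ∩ closedBox (spacing 𝒱) v = closedBox (spacing 𝒱) v :=
    fun v hv => Set.inter_eq_right.2
      (Set.subset_biUnion_of_mem (u := fun v => closedBox (spacing 𝒱) v) hv)
  rw [(isBoxUnion_voxelManifold hδ).setIntegral_eq fun v hv => ?_]
  · refine Finset.sum_congr rfl fun v hv => ?_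
    rw [hinter v hv]
    rfl
  · refine (ContinuousOn.integrableOn_compact (isCompact_closedBox _ v)
      ((continuousOn_vol_metric hU hMU hK hX hpos).mono ?_)).mono_set Set.inter_subset_right
    exact Set.inter_eq_right.1 (hinter v hv)

theorem limitsUnbiased_lkcTopEst (hδ : ∀ d, 0 < spacing 𝒱 d) (hU : IsOpen U)
    (hMU : voxelManifold 𝒱 ⊆ U) (hK : ∀ v : 𝒱, ContDiffOn ℝ 3 (fun s => K s v) U)
    (hX : HasGaussianLaw X P₀) (hpos : ∀ x ∈ voxelManifold 𝒱, 0 < kernelNormSq K X P₀ x)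
    {N : ℕ} (hN : D + 2 ≤ N) :
    LimitsUnbiased (Measure.pi fun _ : Fin N => P₀.map X) (fun r z => lkcTopEst K r z)
      (lkcTop 𝒱 (metric K X P₀)) := by
  refine (limitsUnbiased_submatrix hU hMU hK hX hpos (isBoxUnion_voxelManifold hδ) id contDiff_id
    (fun y hy => hy) (by simpa using hN)).congr (fun k z => ?_) ?_
  · simp only [lkcTopEst, grid_eq, vol, id, submatrix_id_id]
  · rw [lkcTop_metric_eq hδ hU hMU hK hX hpos]
    rfl

/-- For each direction `j` and each height `c`, the faces form a union of boxes of dimension `D -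
1`, which is why `D + 1` observations suffice; the finitely many contributions are added. -/
theorem limitsUnbiased_lkcFacesEst (hδ : ∀ d, 0 < spacing 𝒱 d) (hU : IsOpen U)
    (hMU : voxelManifold 𝒱 ⊆ U) (hK : ∀ v : 𝒱, ContDiffOn ℝ 3 (fun s => K s v) U)
    (hX : HasGaussianLaw X P₀) (hpos : ∀ x ∈ voxelManifold 𝒱, 0 < kernelNormSq K X P₀ x)
    {N : ℕ} (hD : 1 ≤ D) (hN : D + 1 ≤ N) {T : Set (Fin D → ℝ)}
    (hT : T = openVoxels 𝒱 ∨ T = interior (voxelManifold 𝒱)) :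
    LimitsUnbiased (Measure.pi fun _ : Fin N => P₀.map X) (fun r z => lkcFacesEst T K r z)
      (lkcFaces 𝒱 T (metric K X P₀)) := by
  have hcard : ∀ j : Fin D, Fintype.card {i : Fin D // i ≠ j} + 2 ≤ N := fun j => by
    rw [Fintype.card_subtype_compl, Fintype.card_fin, Fintype.card_subtype_eq]
    omega
  have h := LimitsUnbiased.sum (s := Finset.univ) fun (j : Fin D) _ =>
    LimitsUnbiased.sum (s := heights 𝒱 j) fun c _ =>
      limitsUnbiased_submatrix hU hMU hK hX hpos (isBoxUnion_faces hδ hT j c) Subtype.val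
        (contDiff_glue j c) (fun y hy => glue_mem_voxelManifold hy) (hcard j)
  refine h.congr (fun k z => Finset.sum_congr rfl fun j _ => ?_) rfl
  rw [finsum_faces_inter_grid hδ hT j k]
  rfl

end Curvatures

end SuRF

/-! ### The theorem for an i.i.d. sample on an arbitrary probability space -/

theorem theorem2 {D N : ℕ} (hD : 1 ≤ D)
    -- the finite voxel set; in no coordinate direction do all voxels coincide
    (𝒱 : Finset (Fin D → ℝ)) (h𝒱 : ∀ d : Fin D, ∃ v ∈ 𝒱, ∃ w ∈ 𝒱, v d ≠ w d)
    -- the `C^3` kernel on an open neighbourhood of the voxel manifold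
    (U : Set (Fin D → ℝ)) (hU : IsOpen U) (hMU : SuRF.voxelManifold 𝒱 ⊆ U)
    (K : (Fin D → ℝ) → 𝒱 → ℝ) (hK : ∀ v : 𝒱, ContDiffOn ℝ 3 (fun s => K s v) U)
    -- the Gaussian field on the voxels; its super-resolution field can be normalized
    {Ω₀ : Type*} [MeasurableSpace Ω₀] (P₀ : Measure Ω₀) [IsProbabilityMeasure P₀]
    (X : Ω₀ → 𝒱 → ℝ) (hX : HasGaussianLaw X P₀)
    (hpos : ∀ x ∈ SuRF.voxelManifold 𝒱, 0 < SuRF.kernelNormSq K X P₀ x)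
    -- the i.i.d. sample
    {Ω : Type*} [MeasurableSpace Ω] (P : Measure Ω) [IsProbabilityMeasure P]
    (Y : Fin N → Ω → 𝒱 → ℝ) (hindep : iIndepFun Y P)
    (hident : ∀ i, IdentDistrib (Y i) X P P₀) :
    (D + 2 ≤ N →
      SuRF.LimitsUnbiased P (fun r ω => SuRF.lkcTopEst K r (fun i => Y i ω))
        (SuRF.lkcTop 𝒱 (SuRF.metric K X P₀))) ∧
    (D + 1 ≤ N →
      -- the top-dimensional stratum: all open voxels, or the interior of the voxel manifold
      ∀ T : Set (Fin D → ℝ),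
        (T = SuRF.openVoxels 𝒱 ∨ T = interior (SuRF.voxelManifold 𝒱)) →
        SuRF.LimitsUnbiased P (fun r ω => SuRF.lkcFacesEst T K r (fun i => Y i ω))
          (SuRF.lkcFaces 𝒱 T (SuRF.metric K X P₀))) := by
  have hδ : ∀ d, 0 < SuRF.spacing 𝒱 d := fun d => SuRF.spacing_pos (h𝒱 d)
  have hY : ∀ i, AEMeasurable (Y i) P := fun i => (hident i).aemeasurable_fst
  have hYm : AEMeasurable (fun ω i => Y i ω) P := aemeasurable_pi_iff.2 hY
  -- The estimators depend on `ω` only through the sample, whose joint law is this product; it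
  -- remains to treat the canonical sample space.
  have hlaw : P.map (fun ω i => Y i ω) = Measure.pi fun _ : Fin N => P₀.map X := by
    rw [hindep.map_fun_eq_pi_map hY]
    simp only [(hident _).map_eq]
  refine ⟨fun hN => ?_, fun hN T hT => ?_⟩
  · refine SuRF.LimitsUnbiased.comp (est := fun r z => SuRF.lkcTopEst K r z) hYm ?_
    rw [hlaw]
    exact SuRF.limitsUnbiased_lkcTopEst hδ hU hMU hK hX hpos hN
  · refine SuRF.LimitsUnbiased.comp (est := fun r z => SuRF.lkcFacesEst T K r z) hYm ?_
    rw [hlaw]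
    exact SuRF.limitsUnbiased_lkcFacesEst hδ hU hMU hK hX hpos hD hN hT
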